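/- All groups are finite. A subgroup $A$ of a group $G$ is *quasinormal* in $G$ if $AX=XA$ for every subgroup $X$ of $G$; $G$ is a *$PT$-group* if quasinormality is transitive on $G$, that is, whenever $H\le K\le G$, $H$ is quasinormal in $K$ and $K$ is quasinormal in $G$, then $H$ is quasinormal in $G$. A subgroup $M$ of $G$ is *modular* in $G$ if (i) $\langle X, M\cap Z\rangle=\langle X,M\rangle\cap Z$ for all subgroups $X\le Z$ of $G$, and (ii) $\langle M, Y\cap Z\rangle=\langle M,Y\rangle\cap Z$ for all subgroups $Y,Z$ of $G$ with $M\le Z$. A subgroup $A$ of $G$ is *submodular* in $G$ if there is a chain of subgroups $A=A_0\le A_1\le\cdots\le A_n=G$ such that $A_{i-1}$ is modular in $A_i$ for all $i=1,\dots,n$. Finally, $G$ is an *$M$-group* if the lattice of all subgroups of $G$ is modular. **Proposition 4.13.** Let $G$ be a (finite) soluble $PT$-group. 1. Let $p$ be a prime. If every submodular $p$-subgroup of $G$ is modular in $G$, then every $p$-subgroup of $G$ is modular in $G$. 2. In particular, if every submodular subgroup of $G$ is modular in $G$, then $G$ is an $M$-group. -/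

import Mathlib

open scoped Pointwise

/-- `A` is quasinormal (permutable) in `G`: `AX = XA` for every subgroup `X` of `G`. -/
def IsQuasinormalSubgroup {G : Type*} [Group G] (A : Subgroup G) : Prop :=
  ∀ X : Subgroup G, (A : Set G) * (X : Set G) = (X : Set G) * (A : Set G)

/-- `G` is a `PT`-group: quasinormality is a transitive relation on `G`. For `H ≤ K`, the
subgroup `H.subgroupOf K` is `H` regarded as a subgroup of the group `K`. -/
def IsPTGroup (G : Type*) [Group G] : Prop :=
  ∀ H K : Subgroup G, H ≤ K → IsQuasinormalSubgroup (H.subgroupOf K) →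
    IsQuasinormalSubgroup K → IsQuasinormalSubgroup H

/-- `M` is modular in `G`: it is a modular element, in the sense of Kurosh, of the lattice of all
subgroups of `G`. -/
def IsModularSubgroup {G : Type*} [Group G] (M : Subgroup G) : Prop :=
  (∀ X Z : Subgroup G, X ≤ Z → X ⊔ (M ⊓ Z) = (X ⊔ M) ⊓ Z) ∧
  (∀ Y Z : Subgroup G, M ≤ Z → M ⊔ (Y ⊓ Z) = (M ⊔ Y) ⊓ Z)

/-- `A` is submodular in `G`: there is a chain `A = C 0 ≤ C 1 ≤ ⋯ ≤ C n = G` of subgroups in which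
each member is a modular subgroup of the next one. -/
def IsSubmodularSubgroup {G : Type*} [Group G] (A : Subgroup G) : Prop :=
  ∃ (n : ℕ) (C : ℕ → Subgroup G), C 0 = A ∧ C n = ⊤ ∧
    ∀ i < n, C i ≤ C (i + 1) ∧ IsModularSubgroup ((C i).subgroupOf (C (i + 1)))

/-- `G` is an `M`-group: the lattice of all subgroups of `G` is modular. -/
def IsMGroup (G : Type*) [Group G] : Prop :=
  IsModularLattice (Subgroup G)

-- A soluble `PT`-group `G` has a normal Hall subgroup `D` such that every subgroup of `D` is normal
-- in `G` and `G / D` is nilpotent (`IsPTGroup.exists_nilpotent_residual`). Then `G` acts on each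
-- cyclic subgroup of `D` by powers, so commutators lie in `Γ = C_G(D)`.
--
-- Let `U` be a `p`-subgroup. If `p` divides `|D|`, then `U ≤ D` is normal, hence modular. Otherwise
-- `U` has order prime to `|D|`, and two facts are played against each other. If `U ≤ Γ⟨x⟩` with `x
-- ^ p ∈ Γ`, then `U` is submodular (`isSubmodularSubgroup_of_pow_mem_centralizer`): adjoin `D` to
-- `U` in steps of prime index, each step being modular because it lives in a section whose order
-- divides a product of two primes. Conversely, if `x ∈ U` lies outside `Γ` and `(U ∩ Γ)⟨x⟩` is
-- modular, then `U ≤ Γ⟨x⟩` (`le_sup_zpowers_of_isModularSubgroup`). If `U` is not contained in `Γ`,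
-- choose `x ∈ U` outside `Γ` with `x ^ p ∈ Γ`. Then `(U ∩ Γ)⟨x⟩` is submodular, hence modular by
-- hypothesis; so `U ≤ Γ⟨x⟩`, and `U` itself is submodular, hence modular.
--
-- For the second claim, joins of modular subgroups are modular, and every subgroup is the join of
-- its cyclic subgroups of prime power order.

universe u

section

variable {G : Type*} [Group G]

/-! ### Elements of prime power order and conjugation by powers. -/

/-- A subgroup containing every power of prime power order of `d` contains `d`. -/
theorem mem_of_forall_primePow_mem {H : Subgroup G} {n : ℕ} (hn : n ≠ 0) (d : G) (hd : d ^ n = 1)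
    (h : ∀ q : ℕ, q.Prime → ∀ k m : ℕ, (d ^ m) ^ q ^ k = 1 → d ^ m ∈ H) : d ∈ H := by
  induction n using Nat.recOnPosPrimePosCoprime generalizing d with
  | zero => exact absurd rfl hn
  | one => simp_all
  | prime_pow p k hp hk => simpa using h p hp k 1 (by simpa using hd)
  | coprime a b ha hb hab iha ihb =>
    have h1 : d ^ a ∈ H := ihb (by omega) _ (by rw [← pow_mul, hd])
      fun q hq k m hm ↦ by rw [← pow_mul d] at hm ⊢; exact h q hq k _ hm
    have h2 : d ^ b ∈ H := iha (by omega) _ (by rw [← pow_mul, mul_comm, hd])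
      fun q hq k m hm ↦ by rw [← pow_mul d] at hm ⊢; exact h q hq k _ hm
    have e : d = (d ^ a) ^ (Nat.gcdA a b) * (d ^ b) ^ (Nat.gcdB a b) := by
      have := Nat.gcd_eq_gcd_ab a b
      rw [hab.gcd_eq_one] at this
      rw [← zpow_natCast, ← zpow_natCast, ← zpow_mul, ← zpow_mul, ← zpow_add, ← this]
      simp
    rw [e]
    exact mul_mem (zpow_mem h1 _) (zpow_mem h2 _)

theorem mem_of_forall_primePow_mem_of_finite [Finite G] {H : Subgroup G} (d : G)
    (h : ∀ q : ℕ, q.Prime → ∀ k m : ℕ, (d ^ m) ^ q ^ k = 1 → d ^ m ∈ H) : d ∈ H :=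
  mem_of_forall_primePow_mem Nat.card_pos.ne' d pow_card_eq_one' h

theorem mem_zpowers_zpow_of_isCoprime {d : G} {n s : ℤ} (hd : d ^ n = 1) (h : IsCoprime s n) :
    d ∈ Subgroup.zpowers (d ^ s) := by
  obtain ⟨a, b, hab⟩ := h
  refine ⟨a, ?_⟩
  have : d ^ (a * s + b * n) = d := by rw [hab, zpow_one]
  rw [zpow_add, mul_comm b, zpow_mul d n, hd, one_zpow, mul_one, mul_comm, zpow_mul] at this
  exact this

theorem conj_zpow_of_conj_eq {x d : G} {r : ℤ} (h : x * d * x⁻¹ = d ^ r) (i : ℤ) :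
    x * d ^ i * x⁻¹ = (d ^ i) ^ r := by
  rw [← conj_zpow, h, ← zpow_mul, ← zpow_mul, mul_comm]

theorem pow_conj_of_conj_eq {x d : G} {r : ℤ} (h : x * d * x⁻¹ = d ^ r) (n : ℕ) :
    x ^ n * d * (x ^ n)⁻¹ = d ^ r ^ n := by
  induction n with
  | zero => simp
  | succ n ih =>
    rw [pow_succ' x, mul_inv_rev, show x * x ^ n * d * ((x ^ n)⁻¹ * x⁻¹) =
      x * (x ^ n * d * (x ^ n)⁻¹) * x⁻¹ by group, ih, ← conj_zpow, h, ← zpow_mul, pow_succ, mul_comm]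

/-- An element of order prime to `q` that raises an element of `q`-power order to a power congruent
to `1` modulo `q` centralises it. -/
theorem conj_eq_self_of_modEq_one {x d : G} {r : ℤ} {q k n : ℕ} (hq : q.Prime)
    (hd : d ^ q ^ k = 1) (hx : x ^ n = 1) (hn : n.Coprime q) (h : x * d * x⁻¹ = d ^ r)
    (hr : (q : ℤ) ∣ r - 1) : x * d * x⁻¹ = d := by
  have h1 : d = d ^ r ^ n := by simpa [hx] using pow_conj_of_conj_eq h n
  have h2 : (orderOf d : ℤ) ∣ r ^ n - 1 := by
    rw [orderOf_dvd_iff_zpow_eq_one, zpow_sub, ← h1]; simp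
  have h3 : orderOf d ∣ q ^ k := orderOf_dvd_of_pow_eq_one hd
  rw [← mul_geom_sum] at h2
  -- In `r ^ n - 1 = (r - 1) * ∑ r ^ i` the sum is congruent to `n` modulo `q`, hence prime to the
  -- order of `d`.
  have h4 : IsCoprime (orderOf d : ℤ) (∑ i ∈ Finset.range n, r ^ i) := by
    refine IsCoprime.of_isCoprime_of_dvd_left ?_ (Int.natCast_dvd_natCast.2 h3)
    push_cast
    refine IsCoprime.pow_left ?_
    rw [(Nat.prime_iff_prime_int.1 hq).coprime_iff_not_dvd]
    intro hdiv
    have h5 : (∑ i ∈ Finset.range n, r ^ i) ≡ n [ZMOD q] := by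
      have : ∀ i ∈ Finset.range n, r ^ i ≡ 1 [ZMOD q] := fun i _ ↦ by
        simpa using ((Int.modEq_iff_dvd.2 hr).symm.pow i)
      simpa using Int.ModEq.sum this
    have h6 : (q : ℤ) ∣ n := h5.dvd_iff.1 hdiv
    exact (Nat.Prime.coprime_iff_not_dvd hq).1 hn.symm (Int.natCast_dvd_natCast.1 h6)
  have h5 := h4.dvd_of_dvd_mul_right h2
  rw [orderOf_dvd_iff_zpow_eq_one, zpow_sub, zpow_one, mul_inv_eq_one] at h5
  rw [h, h5]

theorem isCoprime_sub_one_of_conj_ne {x d : G} {r : ℤ} {q k n : ℕ} (hq : q.Prime)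
    (hd : d ^ q ^ k = 1) (hx : x ^ n = 1) (hn : n.Coprime q) (h : x * d * x⁻¹ = d ^ r)
    (hne : x * d * x⁻¹ ≠ d) : IsCoprime (r - 1) (q : ℤ) :=
  ((Nat.prime_iff_prime_int.1 hq).coprime_iff_not_dvd.2
    fun hr ↦ hne (conj_eq_self_of_modEq_one hq hd hx hn h hr)).symm

theorem mem_zpowers_zpow_of_isCoprime_prime {d : G} {q k : ℕ} {s : ℤ} (hd : d ^ q ^ k = 1)
    (h : IsCoprime s (q : ℤ)) : d ∈ Subgroup.zpowers (d ^ s) :=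
  mem_zpowers_zpow_of_isCoprime (n := ((q ^ k : ℕ) : ℤ)) (by rw [zpow_natCast, hd])
    (by push_cast; exact h.pow_right)

/-- An element is trivial if a power of it prime to `p` and a `p`-power of it are. -/
theorem eq_one_of_pow_eq_one_of_coprime {x : G} {m n : ℕ} (hm : x ^ m = 1) (hn : x ^ n = 1)
    (h : m.Coprime n) : x = 1 := by
  rw [← orderOf_eq_one_iff, ← Nat.dvd_one, ← h.gcd_eq_one]
  exact Nat.dvd_gcd (orderOf_dvd_of_pow_eq_one hm) (orderOf_dvd_of_pow_eq_one hn)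

/-- A `q`-element lies in a normal subgroup of index prime to `q`. -/
theorem mem_of_pow_eq_one_of_coprime_index {N : Subgroup G} [N.Normal] {x : G} {m : ℕ}
    (hm : x ^ m = 1) (h : m.Coprime N.index) : x ∈ N := by
  rw [← QuotientGroup.eq_one_iff]
  refine eq_one_of_pow_eq_one_of_coprime (m := m) (n := N.index) ?_ ?_ h
  · rw [← QuotientGroup.mk_pow, hm, QuotientGroup.mk_one]
  · rw [Subgroup.index_eq_card, pow_card_eq_one']

/-- Take the least positive `n` with `d ^ n ∈ H` and divide it by one of its prime factors. -/
theorem exists_pow_notMem_prime_pow_mem [Finite G] {H : Subgroup G} {d : G} (hd : d ∉ H) :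
    ∃ q : ℕ, q.Prime ∧ ∃ m : ℕ, d ^ m ∉ H ∧ (d ^ m) ^ q ∈ H := by
  classical
  have hex : ∃ n, 0 < n ∧ d ^ n ∈ H := ⟨Nat.card G, Nat.card_pos, by simp⟩
  obtain ⟨hpos, hmem⟩ := Nat.find_spec hex
  set n := Nat.find hex with hn
  have h1 : n ≠ 1 := fun h ↦ hd (by simpa [h] using hmem)
  refine ⟨n.minFac, Nat.minFac_prime h1, n / n.minFac, fun h ↦ ?_, ?_⟩
  · exact Nat.find_min hex (Nat.div_lt_self hpos (Nat.minFac_prime h1).one_lt)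
      ⟨Nat.div_pos (Nat.minFac_le hpos) (Nat.minFac_pos n), h⟩
  · rwa [← pow_mul, Nat.div_mul_cancel (Nat.minFac_dvd n)]

theorem Subgroup.normal_of_forall_conj_mem_zpowers {H : Subgroup G} [Finite G]
    (h : ∀ d ∈ H, ∀ q : ℕ, q.Prime → ∀ k, d ^ q ^ k = 1 → ∀ g : G, g * d * g⁻¹ ∈ zpowers d) :
    H.Normal := by
  refine ⟨fun d hd g ↦ ?_⟩
  have : d ∈ H.comap (MulAut.conj g).toMonoidHom :=
    mem_of_forall_primePow_mem_of_finite d fun q hq k m hm ↦ by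
      obtain ⟨i, hi⟩ := h _ (pow_mem hd m) q hq k hm g
      rw [Subgroup.mem_comap, MulEquiv.toMonoidHom_eq_coe, MonoidHom.coe_coe, MulAut.conj_apply,
        ← hi]
      exact zpow_mem (pow_mem hd m) i
  simpa using this

/-! ### Quasinormality in `PT`-groups. -/

/-- It suffices to test cyclic `X`, and inverses turn one inclusion of products into the other. This
elementwise form pulls back and pushes forward along homomorphisms. -/
theorem isQuasinormalSubgroup_iff {A : Subgroup G} :
    IsQuasinormalSubgroup A ↔ ∀ a ∈ A, ∀ x : G, ∃ i : ℤ, x ^ i * a * x ∈ A := by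
  constructor
  · intro h a ha x
    have : a * x ∈ (A : Set G) * (Subgroup.zpowers x : Set G) :=
      Set.mul_mem_mul ha (Subgroup.mem_zpowers x)
    rw [h] at this
    obtain ⟨_, ⟨i, rfl⟩, b, hb, hab⟩ := Set.mem_mul.1 this
    refine ⟨-i, ?_⟩
    rw [mul_assoc, ← hab]
    simpa using hb
  · intro h X
    have key : (A : Set G) * (X : Set G) ⊆ (X : Set G) * (A : Set G) := by
      rintro _ ⟨a, ha, x, hx, rfl⟩
      obtain ⟨i, hi⟩ := h a ha x
      exact ⟨x ^ (-i), X.zpow_mem hx _, _, hi, by simp [mul_assoc]⟩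
    refine key.antisymm ?_
    rintro _ ⟨x, hx, a, ha, rfl⟩
    obtain ⟨y, hy, b, hb, h⟩ := key ⟨a⁻¹, A.inv_mem ha, x⁻¹, X.inv_mem hx, rfl⟩
    refine ⟨b⁻¹, A.inv_mem hb, y⁻¹, X.inv_mem hy, ?_⟩
    simpa using congrArg (·⁻¹) h

theorem Subgroup.Normal.isQuasinormalSubgroup {A : Subgroup G} (hA : A.Normal) :
    IsQuasinormalSubgroup A :=
  isQuasinormalSubgroup_iff.2 fun a ha x ↦ ⟨-1, by simpa using hA.conj_mem a ha x⁻¹⟩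

theorem IsPTGroup.of_surjective {G' : Type*} [Group G'] (hPT : IsPTGroup G) (f : G →* G')
    (hf : Function.Surjective f) : IsPTGroup G' := by
  intro H K hHK hH hK
  rw [isQuasinormalSubgroup_iff] at hH hK
  have h := hPT (H.comap f) (K.comap f) (Subgroup.comap_mono hHK)
    (isQuasinormalSubgroup_iff.2 ?_) (isQuasinormalSubgroup_iff.2 ?_)
  · rw [isQuasinormalSubgroup_iff] at h ⊢
    intro a ha x
    obtain ⟨a, rfl⟩ := hf a
    obtain ⟨x, rfl⟩ := hf x
    obtain ⟨i, hi⟩ := h a ha x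
    exact ⟨i, by simpa using hi⟩
  · rintro ⟨a, ha⟩ h ⟨x, hx⟩
    obtain ⟨i, hi⟩ := hH ⟨f a, ha⟩ h ⟨f x, hx⟩
    refine ⟨i, ?_⟩
    simpa [Subgroup.mem_subgroupOf] using hi
  · intro a ha x
    obtain ⟨i, hi⟩ := hK (f a) ha (f x)
    exact ⟨i, by simpa using hi⟩

/-- Subgroups of the nilpotent group `N` grow in their normalisers, so `H` is subnormal;
transitivity carries quasinormality down the chain from `N`. -/
theorem IsPTGroup.isQuasinormalSubgroup_of_le [Finite G] (hPT : IsPTGroup G) {q : ℕ}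
    [Fact q.Prime] {N : Subgroup G} (hN : N.Normal) (hq : IsPGroup q N) (H : Subgroup G)
    (hH : H ≤ N) : IsQuasinormalSubgroup H := by
  induction H using WellFoundedGT.induction with
  | ind H ih =>
  rcases hH.eq_or_lt with rfl | hlt
  · exact hN.isQuasinormalSubgroup
  have := hq.isNilpotent
  have hc := Group.normalizerCondition_of_isNilpotent (G := N) (H.subgroupOf N)
    (lt_top_iff_ne_top.2 fun h ↦ hlt.not_ge (Subgroup.subgroupOf_eq_top.1 h))
  obtain ⟨n, hn, hnH⟩ := SetLike.exists_of_lt hc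
  set K := N ⊓ Subgroup.normalizer (H : Set G) with hKdef
  have hHK : H ≤ K := le_inf hH Subgroup.le_normalizer
  have hnK : (n : G) ∈ K := ⟨n.2, by
    rwa [← Subgroup.subgroupOf_normalizer_eq hH, Subgroup.mem_subgroupOf] at hn⟩
  refine hPT H K hHK ?_ (ih K (lt_of_le_of_ne hHK fun h ↦ ?_) inf_le_left)
  · exact (Subgroup.normal_subgroupOf_of_le_normalizer inf_le_right).isQuasinormalSubgroup
  · exact hnH (Subgroup.mem_subgroupOf.2 (by rw [h]; exact hnK))

/-- In a finite `PT`-group, elements of order prime to `q` normalise all subgroups of a normal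
`q`-subgroup. -/
theorem IsPTGroup.conj_mem_of_coprime [Finite G] (hPT : IsPTGroup G) {q : ℕ} [Fact q.Prime]
    {N : Subgroup G} (hN : N.Normal) (hq : IsPGroup q N) {H : Subgroup G} (hH : H ≤ N) {x : G}
    {n : ℕ} (hx : x ^ n = 1) (hn : n.Coprime q) {a : G} (ha : a ∈ H) : x * a * x⁻¹ ∈ H := by
  obtain ⟨i, hi⟩ := isQuasinormalSubgroup_iff.1
    (hPT.isQuasinormalSubgroup_of_le hN hq H hH) a ha x⁻¹
  -- Modulo `N` the element in `hi` is this power. Being both a `q`-element and of order prime to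
  -- `q`, the power is trivial, so `x⁻¹ ^ i = x`.
  have h1 : (x⁻¹) ^ (i + 1) ∈ N := by
    have h2 := N.mul_mem (hH hi) (N.inv_mem (hN.conj_mem a (hH ha) x))
    rwa [show x⁻¹ ^ i * a * x⁻¹ * (x * a * x⁻¹)⁻¹ = (x⁻¹) ^ (i + 1) by group] at h2
  obtain ⟨k, hk⟩ := hq ⟨_, h1⟩
  have h3 : (x⁻¹) ^ (i + 1) = 1 :=
    eq_one_of_pow_eq_one_of_coprime (m := n) (n := q ^ k)
      (by rw [← zpow_natCast, zpow_comm, zpow_natCast]; simp [hx])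
      (by simpa [Subtype.ext_iff] using hk) (hn.pow_right k)
  rw [zpow_add_one, mul_inv_eq_one] at h3
  rwa [h3] at hi

/-! ### Normal subgroups of prime order and the normal Sylow subgroup. -/

theorem eq_top_of_forall_prime_not_dvd_index {H : Subgroup G}
    (h : ∀ r : ℕ, r.Prime → ¬ r ∣ H.index) : H = ⊤ :=
  Subgroup.index_eq_one.1 (Nat.eq_one_iff_not_exists_prime_dvd.2 h)

/-- The last nontrivial derived subgroup is abelian, so its Sylow subgroups are characteristic in
it. -/
theorem exists_ne_bot_normal_isPGroup [Finite G] [Group.IsSolvable G] [Nontrivial G] :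
    ∃ q : ℕ, q.Prime ∧ ∃ N : Subgroup G, N.Normal ∧ N ≠ ⊥ ∧ IsPGroup q N := by
  classical
  obtain ⟨A, hA, hA1, hAc⟩ : ∃ A : Subgroup G, A.Normal ∧ A ≠ ⊥ ∧ ⁅A, A⁆ = ⊥ := by
    have hex : ∃ n, derivedSeries G n = ⊥ := (Group.isSolvable_def G).1 inferInstance
    have hn := Nat.find_spec hex
    obtain ⟨m, hm⟩ : ∃ m, Nat.find hex = m + 1 := Nat.exists_eq_succ_of_ne_zero fun h ↦ by
      rw [h] at hn; exact top_ne_bot hn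
    rw [hm] at hn
    exact ⟨derivedSeries G m, inferInstance, Nat.find_min hex (by omega), hn⟩
  have hcomm : ∀ a b : A, a * b = b * a := fun a b ↦ Subtype.ext <| by
    have := Subgroup.commutator_mem_commutator a.2 b.2
    rw [hAc, Subgroup.mem_bot, commutatorElement_eq_one_iff_mul_comm] at this
    exact this
  obtain ⟨q, hq, hdvd⟩ := Nat.exists_prime_and_dvd (n := Nat.card A)
    fun h ↦ hA1 (Subgroup.card_eq_one.1 h)
  have := Fact.mk hq
  let P : Sylow q A := default
  have hP : (P : Subgroup A).Normal :=
    ⟨fun n hn g ↦ by rwa [hcomm g n, mul_inv_cancel_right]⟩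
  have := P.characteristic_of_normal hP
  refine ⟨q, hq, (P : Subgroup A).map A.subtype, inferInstance, ?_, P.2.map _⟩
  rw [Ne, Subgroup.map_eq_bot_iff_of_injective _ A.subtype_injective]
  exact P.ne_bot_of_dvd_card hdvd

/-- A nontrivial finite soluble `PT`-group has a normal subgroup of prime order. -/
theorem IsPTGroup.exists_normal_card_prime [Finite G] [Group.IsSolvable G] [Nontrivial G]
    (hPT : IsPTGroup G) : ∃ N : Subgroup G, N.Normal ∧ (Nat.card N).Prime := by
  obtain ⟨q, hq, N, hN, hN1, hNq⟩ := exists_ne_bot_normal_isPGroup (G := G)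
  have := Fact.mk hq
  obtain ⟨Q⟩ : Nonempty (Sylow q G) := inferInstance
  -- A Sylow `q`-subgroup acting by conjugation on the `q`-group `N` fixes a nontrivial element.
  obtain ⟨z, hz1, hz⟩ : ∃ z : N, z ≠ 1 ∧ ∀ g ∈ Q, g * (z : G) * g⁻¹ = z := by
    let _ : MulAction Q N := MulAction.compHom N ((MulAut.conjNormal (H := N)).comp (Q : Subgroup G).subtype)
    have hact : ∀ (g : Q) (n : N), ((g • n : N) : G) = g * n * (g : G)⁻¹ := fun g n ↦ rfl
    obtain ⟨z, hz, hz1⟩ := Q.2.exists_fixed_point_of_prime_dvd_card_of_fixed_point N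
      (((hNq.card_eq_or_dvd).resolve_left fun h ↦ hN1 (Subgroup.card_eq_one.1 h))) (a := 1)
      (fun g ↦ Subtype.ext (by rw [hact]; simp))
    exact ⟨z, hz1.symm, fun g hg ↦ by rw [← hact ⟨g, hg⟩ z, hz]⟩
  obtain ⟨k, hk⟩ := (IsPGroup.iff_orderOf.1 hNq) z
  have hk0 : k ≠ 0 := fun h ↦ hz1 (by rw [← orderOf_eq_one_iff, hk, h, pow_zero])
  obtain ⟨k, rfl⟩ := Nat.exists_eq_succ_of_ne_zero hk0
  set y : G := (z : G) ^ q ^ k with hy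
  have hyo : orderOf y = q := by
    rw [hy, orderOf_pow_of_dvd (pow_ne_zero _ hq.ne_zero), Subgroup.orderOf_coe, hk]
    · rw [pow_succ, Nat.mul_div_cancel_left _ (pow_pos hq.pos _)]
    · rw [Subgroup.orderOf_coe, hk]; exact pow_dvd_pow _ k.le_succ
  have hyN : Subgroup.zpowers y ≤ N := by
    rw [Subgroup.zpowers_le]; exact pow_mem z.2 _
  refine ⟨Subgroup.zpowers y, ?_, by rwa [Nat.card_zpowers, hyo]⟩
  -- The normaliser of `⟨y⟩` contains a Sylow subgroup for every prime: `Q` centralises `y`, and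
  -- elements of order prime to `q` normalise all subgroups of `N`.
  rw [← Subgroup.normalizer_eq_top_iff]
  refine eq_top_of_forall_prime_not_dvd_index fun r hr hdvd ↦ ?_
  have := Fact.mk hr
  obtain ⟨R⟩ : Nonempty (Sylow r G) := inferInstance
  suffices h : (if r = q then (Q : Subgroup G) else R) ≤
      Subgroup.normalizer (Subgroup.zpowers y : Set G) by
    split_ifs at h with h1
    · subst h1; exact Q.not_dvd_index (hdvd.trans (Subgroup.index_dvd_of_le h))
    · exact R.not_dvd_index (hdvd.trans (Subgroup.index_dvd_of_le h))
  have key : ∀ B : Subgroup G, (∀ g ∈ B, g * y * g⁻¹ ∈ Subgroup.zpowers y) →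
      B ≤ Subgroup.normalizer (Subgroup.zpowers y : Set G) := fun B hB ↦ by
    have hB' : ∀ g ∈ B, ∀ w ∈ Subgroup.zpowers y, g * w * g⁻¹ ∈ Subgroup.zpowers y := by
      rintro g hg _ ⟨i, rfl⟩
      simp only [← conj_zpow]
      exact zpow_mem (hB g hg) i
    refine fun g hg ↦ Subgroup.mem_normalizer_iff.2 fun w ↦ ⟨hB' g hg w, fun h ↦ ?_⟩
    simpa [mul_assoc] using hB' g⁻¹ (inv_mem hg) _ h
  split_ifs with h1
  · refine key _ fun g hg ↦ ?_
    rw [hy, ← conj_pow, hz g hg, ← hy]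
    exact Subgroup.mem_zpowers y
  · refine key _ fun g hg ↦ ?_
    obtain ⟨j, hj⟩ := R.2 ⟨g, hg⟩
    exact hPT.conj_mem_of_coprime hN hNq hyN (n := r ^ j) (by simpa [Subtype.ext_iff] using hj)
      (Nat.Coprime.pow_left _ ((Nat.coprime_primes hr hq).2 h1)) (Subgroup.mem_zpowers y)

/-- A finite soluble `PT`-group has a normal Sylow `q`-subgroup for its largest prime `q`. -/
theorem IsPTGroup.exists_normal_isPGroup_not_dvd_index {q : ℕ} (hq : q.Prime) (n : ℕ) :
    ∀ (G : Type*) [Group G] [Finite G] [Group.IsSolvable G], IsPTGroup G → Nat.card G = n →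
      (∀ r : ℕ, r.Prime → r ∣ Nat.card G → r ≤ q) →
      ∃ Q : Subgroup G, Q.Normal ∧ IsPGroup q Q ∧ ¬ q ∣ Q.index := by
  have := Fact.mk hq
  induction n using Nat.strong_induction_on with
  | _ n ih =>
  intro G _ _ _ hPT hn hmax
  rcases subsingleton_or_nontrivial G with hG | hG
  · exact ⟨⊥, inferInstance, IsPGroup.of_bot, by
      rw [Subgroup.index_bot, Nat.card_eq_one_iff_unique.2 ⟨hG, ⟨1⟩⟩]; exact hq.not_dvd_one⟩
  obtain ⟨N, hN, hNp⟩ := hPT.exists_normal_card_prime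
  have hmul := N.card_mul_index
  obtain ⟨Q, hQ, hQq, hQi⟩ := ih (Nat.card (G ⧸ N)) (by
      rw [← hn, ← hmul, ← Subgroup.index_eq_card]
      exact lt_mul_of_one_lt_left (Nat.pos_of_ne_zero Subgroup.index_ne_zero_of_finite)
        hNp.one_lt) (G ⧸ N)
    (hPT.of_surjective _ (QuotientGroup.mk'_surjective N)) rfl
    fun r hr h ↦ hmax r hr (h.trans (Subgroup.card_quotient_dvd_card N))
  set K := Q.comap (QuotientGroup.mk' N) with hK
  have hKi : K.index = Q.index :=
    Subgroup.index_comap_of_surjective Q (QuotientGroup.mk'_surjective N)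
  have hNK : N ≤ K := by
    simpa using (QuotientGroup.mk' N).ker_le_comap Q
  have hr := hmax _ hNp (N.card_subgroup_dvd_card)
  rcases hr.eq_or_lt with hr | hr
  · refine ⟨K, inferInstance, hQq.comap_of_ker_isPGroup _ ?_, by rwa [hKi]⟩
    rw [QuotientGroup.ker_mk']
    exact IsPGroup.of_card (n := 1) (by rw [hr, pow_one])
  -- Now `|N|` is a prime below `q`. The number of Sylow `q`-subgroups of `K` divides `|N|` and is
  -- `1` modulo `q`, so it is `1`.
  let T : Sylow q K := default
  have hKcard : ∃ a, Nat.card K = Nat.card N * q ^ a := by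
    obtain ⟨a, ha⟩ := IsPGroup.iff_card.1 hQq
    refine ⟨a, ?_⟩
    have h1 := K.card_mul_index
    have h2 := Q.card_mul_index
    rw [← Subgroup.index_eq_card] at h2
    refine Nat.eq_of_mul_eq_mul_right (Nat.pos_of_ne_zero
      (Subgroup.index_ne_zero_of_finite (H := Q))) ?_
    rw [← ha, mul_assoc, h2, hmul, ← h1, hKi]
  have hT : Subsingleton (Sylow q K) := by
    rw [← Finite.card_le_one_iff_subsingleton]
    have h1 : Nat.card (Sylow q K) ∣ Nat.card N := by
      obtain ⟨a, ha⟩ := hKcard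
      have h2 : Nat.card (Sylow q K) ∣ Nat.card N * q ^ a :=
        ha ▸ T.card_dvd_index.trans (T : Subgroup K).index_dvd_card
      refine Nat.Coprime.dvd_of_dvd_mul_right ?_ h2
      refine Nat.Coprime.pow_right _ ?_
      rw [Nat.coprime_comm, hq.coprime_iff_not_dvd]
      intro h3
      have := (card_sylow_modEq_one q K).dvd_iff (dvd_refl q)
      exact hq.not_dvd_one (this.1 h3)
    have h2 := Nat.le_of_dvd hNp.pos h1
    have h3 := card_sylow_modEq_one q K
    rw [Nat.ModEq, Nat.mod_eq_of_lt (by omega), Nat.mod_eq_of_lt hq.one_lt] at h3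
    exact h3.le
  have hTn : (T : Subgroup K).Normal := T.normal_of_subsingleton
  have := T.characteristic_of_normal hTn
  refine ⟨(T : Subgroup K).map K.subtype, inferInstance, T.2.map _, ?_⟩
  rw [Subgroup.index_map_subtype, hKi, hq.dvd_mul, not_or]
  exact ⟨T.not_dvd_index, hQi⟩

/-! ### Power automorphisms of `q`-groups. -/

theorem orderOf_pow_prime_pow_pred {d : G} {q k : ℕ} (hq : q.Prime) (hd : orderOf d = q ^ (k + 1)) :
    orderOf (d ^ q ^ k) = q := by
  rw [orderOf_pow_of_dvd (pow_ne_zero _ hq.ne_zero), hd, pow_succ,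
    Nat.mul_div_cancel_left _ (pow_pos hq.pos _)]
  exact hd ▸ pow_dvd_pow _ k.le_succ

theorem IsPGroup.exists_orderOf_eq_pow_succ {q : ℕ} [Fact q.Prime] {Q : Subgroup G}
    (hQ : IsPGroup q Q) {d : G} (hd : d ∈ Q) (hd1 : d ≠ 1) : ∃ k, orderOf d = q ^ (k + 1) := by
  obtain ⟨k, hk⟩ := (IsPGroup.iff_orderOf.1 hQ) ⟨d, hd⟩
  rw [Subgroup.orderOf_mk] at hk
  cases k with
  | zero => exact absurd (by simpa using hk) hd1
  | succ k => exact ⟨k, hk⟩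

theorem not_dvd_of_conj_eq_zpow {q k : ℕ} (hq : q.Prime) {x d : G} {r : ℤ}
    (hd : orderOf d = q ^ (k + 1)) (h : x * d * x⁻¹ = d ^ r) : ¬ (q : ℤ) ∣ r := by
  rintro ⟨s, rfl⟩
  have h1 : (x * d * x⁻¹) ^ q ^ k = 1 := by
    rw [h, ← zpow_natCast, ← zpow_mul, show (q : ℤ) * s * ((q ^ k : ℕ) : ℤ) =
      ((q ^ (k + 1) : ℕ) : ℤ) * s by push_cast; ring, zpow_mul, zpow_natCast, ← hd,
      pow_orderOf_eq_one, one_zpow]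
  rw [conj_pow, conj_eq_one_iff] at h1
  have h2 := orderOf_dvd_of_pow_eq_one h1
  rw [hd, Nat.pow_dvd_pow_iff_le_right hq.one_lt] at h2
  omega

/-- A power automorphism of a finite `q`-group raises all its nontrivial elements to powers that
agree modulo `q`. -/
theorem exists_forall_conj_eq_zpow_modEq [Finite G] {q : ℕ} [hq : Fact q.Prime] {Q : Subgroup G}
    (hQ : IsPGroup q Q) {x : G} (hx : ∀ d ∈ Q, x * d * x⁻¹ ∈ Subgroup.zpowers d) :
    ∃ ρ : ℤ, ∀ d ∈ Q, d ≠ 1 → ∀ r : ℤ, x * d * x⁻¹ = d ^ r → r ≡ ρ [ZMOD q] := by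
  rcases subsingleton_or_nontrivial Q with hs | hs
  · exact ⟨0, fun d hd hd1 ↦ absurd (congrArg Subtype.val (Subsingleton.elim (⟨d, hd⟩ : Q) 1)) hd1⟩
  have := hQ.center_nontrivial
  obtain ⟨⟨⟨w, hwQ⟩, hwc⟩, hw1⟩ := exists_ne (1 : Subgroup.center Q)
  have hw1 : w ≠ 1 := fun h ↦ hw1 (by ext; exact h)
  obtain ⟨k, hk⟩ := hQ.exists_orderOf_eq_pow_succ hwQ hw1
  set z := w ^ q ^ k with hz
  have hzq : orderOf z = q := orderOf_pow_prime_pow_pred hq.out hk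
  have hzQ : z ∈ Q := pow_mem hwQ _
  have hzc : ∀ d ∈ Q, Commute d z := fun d hd ↦ by
    refine Commute.pow_right ?_ _
    exact congrArg Subtype.val (Subgroup.mem_center_iff.1 hwc ⟨d, hd⟩)
  obtain ⟨ρ, hρ⟩ := Subgroup.mem_zpowers_iff.1 (hx z hzQ)
  have dvd_iff : ∀ d : G, orderOf d = q → ∀ i j : ℤ, d ^ i = d ^ j → i ≡ j [ZMOD q] := by
    intro d hd i j h
    rwa [zpow_eq_zpow_iff_modEq, hd] at h
  refine ⟨ρ, ?_⟩
  have key : ∀ d ∈ Q, orderOf d = q → ∀ r : ℤ, x * d * x⁻¹ = d ^ r → r ≡ ρ [ZMOD q] := by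
    intro d hd hdq r hr
    by_cases hdz : d ∈ Subgroup.zpowers z
    · obtain ⟨i, rfl⟩ := hdz
      refine dvd_iff _ hdq _ _ ?_
      rw [← hr]
      exact conj_zpow_of_conj_eq hρ.symm i
    -- The exponent on `d * z` links those on `d` and on the central element `z`: `d ^ (s - r) = z ^
    -- (ρ - s)`, and both sides must vanish when `d ∉ ⟨z⟩`.
    obtain ⟨s, hs⟩ := Subgroup.mem_zpowers_iff.1 (hx (d * z) (mul_mem hd hzQ))
    have h1 : d ^ s * z ^ s = d ^ r * z ^ ρ := by
      rw [← (hzc d hd).mul_zpow, ← hr, hs, hρ]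
      group
    have h2 : d ^ (-r + s) = z ^ (ρ - s) := calc
      d ^ (-r + s) = d ^ (-r) * (d ^ s * z ^ s) * z ^ (-s) := by group
      _ = z ^ (ρ - s) := by rw [h1]; group
    by_cases hdvd : (q : ℤ) ∣ -r + s
    · have h3 : d ^ (-r + s) = 1 := orderOf_dvd_iff_zpow_eq_one.1 (by rwa [hdq])
      rw [h3, eq_comm, ← orderOf_dvd_iff_zpow_eq_one, hzq] at h2
      rw [Int.modEq_iff_dvd]
      rw [show ρ - r = (ρ - s) + (-r + s) by ring]
      exact dvd_add h2 hdvd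
    · refine absurd ?_ hdz
      have h3 : IsCoprime (-r + s) (q : ℤ) :=
        ((Nat.prime_iff_prime_int.1 hq.out).coprime_iff_not_dvd.2 hdvd).symm
      have hdo : d ^ (q : ℤ) = 1 := by rw [zpow_natCast, ← hdq, pow_orderOf_eq_one]
      have h4 := mem_zpowers_zpow_of_isCoprime hdo h3
      rw [h2] at h4
      exact (Subgroup.zpowers_le.2 (zpow_mem (Subgroup.mem_zpowers z) _)) h4
  intro d hd hd1 r hr
  obtain ⟨l, hl⟩ := hQ.exists_orderOf_eq_pow_succ hd hd1
  refine key (d ^ q ^ l) (pow_mem hd _) (orderOf_pow_prime_pow_pred hq.out hl) r ?_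
  have := conj_zpow_of_conj_eq hr (q ^ l : ℕ)
  rwa [zpow_natCast] at this

theorem isCoprime_sub_one_of_exists_conj_ne [Finite G] {q n : ℕ} [hq : Fact q.Prime]
    {Q : Subgroup G} (hQ : IsPGroup q Q) {x : G} (hx : ∀ d ∈ Q, x * d * x⁻¹ ∈ Subgroup.zpowers d)
    (hxn : x ^ n = 1) (hn : n.Coprime q) (hne : ∃ d ∈ Q, x * d * x⁻¹ ≠ d) :
    ∃ ρ : ℤ, IsCoprime (ρ - 1) (q : ℤ) ∧
      ∀ d ∈ Q, d ≠ 1 → ∀ r : ℤ, x * d * x⁻¹ = d ^ r → r ≡ ρ [ZMOD q] := by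
  obtain ⟨ρ, hρ⟩ := exists_forall_conj_eq_zpow_modEq hQ hx
  refine ⟨ρ, ?_, hρ⟩
  obtain ⟨d, hd, hdx⟩ := hne
  obtain ⟨r, hr⟩ := Subgroup.mem_zpowers_iff.1 (hx d hd)
  have hd1 : d ≠ 1 := fun h ↦ hdx (by simp [h])
  obtain ⟨k, hk⟩ := hQ ⟨d, hd⟩
  have h1 := isCoprime_sub_one_of_conj_ne hq.out (by simpa [Subtype.ext_iff] using hk) hxn hn
    hr.symm hdx
  have h2 := (hρ d hd hd1 r hr.symm).sub_right 1
  obtain ⟨c, hc⟩ := h2.symm.dvd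
  obtain ⟨a, b, hab⟩ := h1
  exact ⟨a, b + a * c, by linear_combination hab - a * hc⟩

/-- A finite `q`-group with a nontrivial power automorphism of order prime to `q` is abelian. -/
theorem commute_of_exists_conj_ne [Finite G] {q n : ℕ} [hq : Fact q.Prime]
    {Q : Subgroup G} (hQ : IsPGroup q Q) {x : G} (hx : ∀ d ∈ Q, x * d * x⁻¹ ∈ Subgroup.zpowers d)
    (hxn : x ^ n = 1) (hn : n.Coprime q) (hne : ∃ d ∈ Q, x * d * x⁻¹ ≠ d) {d e : G}
    (hd : d ∈ Q) (he : e ∈ Q) : Commute d e := by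
  obtain ⟨ρ, hρ1, hρ⟩ := isCoprime_sub_one_of_exists_conj_ne hQ hx hxn hn hne
  have cop : ∀ r : ℤ, r ≡ ρ [ZMOD q] → IsCoprime (r - 1) (q : ℤ) := fun r hr ↦ by
    obtain ⟨c, hc⟩ := hr.dvd
    obtain ⟨a, b, hab⟩ := hρ1
    exact ⟨a, b + a * c, by linear_combination hab - a * hc⟩
  have qpow : ∀ d ∈ Q, ∃ k, d ^ q ^ k = 1 := fun d hd ↦ by
    obtain ⟨k, hk⟩ := hQ ⟨d, hd⟩
    exact ⟨k, by simpa [Subtype.ext_iff] using hk⟩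
  -- Conjugating `d * e * d⁻¹` by `x` shows that `d ^ (t - 1)` normalises `⟨e⟩`; as `t - 1` is prime
  -- to `q`, so does `d`.
  have hnorm : ∀ d ∈ Q, ∀ e ∈ Q, d * e * d⁻¹ ∈ Subgroup.zpowers e := by
    intro d hd e he
    rcases eq_or_ne d 1 with rfl | hd1
    · simp
    rcases eq_or_ne e 1 with rfl | he1
    · simp
    obtain ⟨t, ht⟩ := Subgroup.mem_zpowers_iff.1 (hx d hd)
    obtain ⟨r, hr⟩ := Subgroup.mem_zpowers_iff.1 (hx e he)
    obtain ⟨s, hs⟩ := Subgroup.mem_zpowers_iff.1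
      (hx (d * e * d⁻¹) (mul_mem (mul_mem hd he) (inv_mem hd)))
    have h1 : d ^ (t - 1) * e ^ r * (d ^ (t - 1))⁻¹ = e ^ s := by
      rw [conj_zpow] at hs
      have h2 : d * e ^ s * d⁻¹ = d ^ t * e ^ r * (d ^ t)⁻¹ := by rw [hs, ht, hr]; group
      calc _ = d⁻¹ * (d ^ t * e ^ r * (d ^ t)⁻¹) * d := by group
        _ = _ := by rw [← h2]; group
    obtain ⟨l, hl⟩ := hQ.exists_orderOf_eq_pow_succ he he1
    have h2 : e ∈ Subgroup.zpowers (e ^ r) :=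
      mem_zpowers_zpow_of_isCoprime_prime (by rw [← hl, pow_orderOf_eq_one])
        ((Nat.prime_iff_prime_int.1 hq.out).coprime_iff_not_dvd.2
          (not_dvd_of_conj_eq_zpow hq.out hl hr.symm)).symm
    have h3 : d ^ (t - 1) ∈ Subgroup.normalizer (Subgroup.zpowers e : Set G) := by
      refine Subgroup.mem_normalizer_fintype ?_
      intro w hw
      have hle : Subgroup.zpowers e ≤ Subgroup.zpowers (e ^ r) := Subgroup.zpowers_le.2 h2
      obtain ⟨i, rfl⟩ := Subgroup.mem_zpowers_iff.1 (hle hw)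
      rw [← conj_zpow, h1]
      exact zpow_mem (zpow_mem (Subgroup.mem_zpowers e) _) _
    obtain ⟨k, hk⟩ := qpow d hd
    have h4 := mem_zpowers_zpow_of_isCoprime_prime hk (cop t (hρ d hd hd1 t ht.symm))
    have h5 := (Subgroup.zpowers_le.2 h3) h4
    exact (Subgroup.mem_normalizer_iff.1 h5 e).1 (Subgroup.mem_zpowers e)
  by_contra hc
  -- `c` lies in `⟨d⟩ ∩ ⟨e⟩`, so it commutes with both. Then `x` raises `c` to a power congruent to
  -- both `ρ` and `ρ ^ 2`, which forces `q ∣ ρ`.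
  set c := d * e * d⁻¹ * e⁻¹ with hcdef
  have hc1 : c ≠ 1 := fun h ↦ hc (by rwa [hcdef, mul_inv_eq_one, mul_inv_eq_iff_eq_mul] at h)
  have hcQ : c ∈ Q := mul_mem (mul_mem (mul_mem hd he) (inv_mem hd)) (inv_mem he)
  have hce : Commute c e := by
    obtain ⟨i, hi⟩ := Subgroup.mem_zpowers_iff.1 (hnorm d hd e he)
    rw [hcdef, ← hi]
    exact ((Commute.refl e).zpow_left i).mul_left (Commute.refl e).inv_left
  have hcd : Commute c d := by
    obtain ⟨i, hi⟩ := Subgroup.mem_zpowers_iff.1 (hnorm e he d hd)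
    have : c = d * (d ^ i)⁻¹ := by rw [hi, hcdef]; group
    rw [this]
    exact (Commute.refl d).mul_left ((Commute.refl d).zpow_left i).inv_left
  have hd1 : d ≠ 1 := fun h ↦ hc (h ▸ Commute.one_left e)
  have he1 : e ≠ 1 := fun h ↦ hc (h ▸ Commute.one_right d)
  obtain ⟨t, ht⟩ := Subgroup.mem_zpowers_iff.1 (hx d hd)
  obtain ⟨r, hr⟩ := Subgroup.mem_zpowers_iff.1 (hx e he)
  have h1 : d * e ^ r * d⁻¹ = c ^ r * e ^ r := by
    rw [← hce.mul_zpow, ← conj_zpow, hcdef, inv_mul_cancel_right]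
  have h2 : e ^ r * d * (e ^ r)⁻¹ = c ^ (-r) * d := by
    rw [zpow_neg, eq_inv_mul_iff_mul_eq, mul_inv_eq_iff_eq_mul.1 h1 |> fun h ↦ show
      c ^ r * (e ^ r * d * (e ^ r)⁻¹) = d * e ^ r * (e ^ r)⁻¹ by rw [h]; group]
    group
  have h3 : e ^ r * d ^ t * (e ^ r)⁻¹ = c ^ (-r * t) * d ^ t := by
    rw [← conj_zpow, h2, (hcd.zpow_left _).mul_zpow, ← zpow_mul]
  have h4 : x * c * x⁻¹ = c ^ (t * r) := by
    have h5 : x * c * x⁻¹ = d ^ t * e ^ r * (d ^ t)⁻¹ * (e ^ r)⁻¹ := by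
      rw [ht, hr, hcdef]; group
    rw [h5, show d ^ t * e ^ r * (d ^ t)⁻¹ * (e ^ r)⁻¹ =
      d ^ t * (e ^ r * d ^ t * (e ^ r)⁻¹)⁻¹ by group, h3, mul_inv_rev, mul_inv_cancel_left,
      ← zpow_neg]
    congr 1; ring
  obtain ⟨l, hl⟩ := hQ.exists_orderOf_eq_pow_succ hcQ hc1
  have h5 := not_dvd_of_conj_eq_zpow hq.out hl h4
  have h6 := hρ c hcQ hc1 _ h4
  have h7 := (hρ d hd hd1 t ht.symm).mul (hρ e he he1 r hr.symm)
  have h8 : (q : ℤ) ∣ ρ * (ρ - 1) := by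
    have := (h6.symm.trans h7).dvd
    rwa [show ρ * ρ - ρ = ρ * (ρ - 1) by ring] at this
  exact h5 (h6.dvd_iff.2 (hρ1.symm.dvd_of_dvd_mul_right h8))

/-! ### The structure of soluble `PT`-groups. -/

theorem mem_normalizer_zpowers [Finite G] {g d : G} (h : g * d * g⁻¹ ∈ Subgroup.zpowers d) :
    g ∈ Subgroup.normalizer (Subgroup.zpowers d : Set G) := by
  refine Subgroup.mem_normalizer_fintype ?_
  rintro _ ⟨i, rfl⟩
  simp only [← conj_zpow]
  exact zpow_mem h i

/-- Automorphisms of a cyclic group commute, so `G` acts on `⟨d⟩` through an abelian group. -/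
theorem conj_eq_self_of_mem_commutator {d : G} (h : ∀ g : G, g * d * g⁻¹ ∈ Subgroup.zpowers d)
    {c : G} (hc : c ∈ commutator G) : c * d * c⁻¹ = d := by
  have hle : commutator G ≤ Subgroup.centralizer {d} := by
    rw [commutator_def, Subgroup.commutator_le]
    have key : ∀ u v : G, (u * v) * d * (u * v)⁻¹ = (v * u) * d * (v * u)⁻¹ := by
      intro u v
      obtain ⟨a, ha⟩ := Subgroup.mem_zpowers_iff.1 (h u)
      obtain ⟨b, hb⟩ := Subgroup.mem_zpowers_iff.1 (h v)
      calc _ = u * (v * d * v⁻¹) * u⁻¹ := by group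
        _ = v * (u * d * u⁻¹) * v⁻¹ := by
          rw [← hb, ← ha, ← conj_zpow, ← conj_zpow, ← hb, ← ha, ← zpow_mul, ← zpow_mul, mul_comm]
        _ = _ := by group
    intro g₁ _ g₂ _
    rw [Subgroup.mem_centralizer_singleton_iff, commutatorElement_def, ← mul_inv_eq_iff_eq_mul]
    calc _ = (g₁ * g₂) * ((g₁⁻¹ * g₂⁻¹) * d * (g₁⁻¹ * g₂⁻¹)⁻¹) * (g₁ * g₂)⁻¹ := by group
      _ = d := by
        rw [key g₁⁻¹ g₂⁻¹]
        group
  have := Subgroup.mem_centralizer_singleton_iff.1 (hle hc)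
  rw [mul_inv_eq_iff_eq_mul, this]

/-- Induction through `G / Q`, with `Q` the normal Sylow subgroup for the largest prime `q`, and `B`
the subgroup found in `G / Q`. If all elements of order prime to `q` centralise `Q`, then `G = Q ×
R` and `D` is the part of the preimage of `B` in `R`. Otherwise `Q` is abelian, its subgroups are
normal in `G`, `Q` lies in the commutator subgroup, and `D` is the whole preimage. The clause `D ≤
commutator G` serves the induction. -/
theorem IsPTGroup.exists_nilpotent_residual (n : ℕ) :
    ∀ (G : Type u) [Group G] [Finite G] [Group.IsSolvable G], IsPTGroup G → Nat.card G = n →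
      ∃ D : Subgroup G, D ≤ commutator G ∧
        (∀ d ∈ D, ∀ p : ℕ, p.Prime → ∀ k, d ^ p ^ k = 1 →
          ∀ g : G, g * d * g⁻¹ ∈ Subgroup.zpowers d) ∧
        (∀ p : ℕ, p.Prime → p ∣ Nat.card D → ∀ (x : G) (k : ℕ), x ^ p ^ k = 1 → x ∈ D) ∧
        ∃ (K : Type u) (_ : Group K) (_ : Group.IsNilpotent K) (φ : G →* K), φ.ker = D := by
  induction n using Nat.strong_induction_on with
  | _ n ih =>
  intro G _ _ _ hPT hn
  rcases subsingleton_or_nontrivial G with hG | hG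
  · refine ⟨⊥, bot_le, ?_, ?_, G, inferInstance, inferInstance, MonoidHom.id G, ?_⟩
    · intro d hd p hp k hk g
      rw [Subsingleton.elim (g * d * g⁻¹) 1]
      exact one_mem _
    · intro p hp _ x k _
      rw [Subsingleton.elim x 1]; exact one_mem _
    · rw [eq_bot_iff]; intro x hx; rw [Subsingleton.elim x 1]; exact one_mem _
  obtain ⟨q, hq, hqG, hmax⟩ : ∃ q : ℕ, q.Prime ∧ q ∣ Nat.card G ∧
      ∀ r : ℕ, r.Prime → r ∣ Nat.card G → r ≤ q := by
    have hne : (Nat.card G).primeFactors.Nonempty :=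
      Nat.nonempty_primeFactors.2 Finite.one_lt_card
    have := Finset.max'_mem _ hne
    refine ⟨_, Nat.prime_of_mem_primeFactors this, Nat.dvd_of_mem_primeFactors this,
      fun r hr h ↦ Finset.le_max' _ _ (Nat.mem_primeFactors.2 ⟨hr, h, Nat.card_pos.ne'⟩)⟩
  have := Fact.mk hq
  obtain ⟨Q, hQ, hQq, hQi⟩ := IsPTGroup.exists_normal_isPGroup_not_dvd_index hq _ G hPT rfl hmax
  have hQi' : q.Coprime Q.index := hq.coprime_iff_not_dvd.2 hQi
  have hQcard : 1 < Nat.card Q := by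
    rw [Finite.one_lt_card_iff_nontrivial, Subgroup.nontrivial_iff_ne_bot]
    rintro rfl
    exact hQi (by rwa [Subgroup.index_bot])
  have memQ : ∀ (x : G) (k : ℕ), x ^ q ^ k = 1 → x ∈ Q := fun x k hx ↦
    mem_of_pow_eq_one_of_coprime_index hx (hQi'.pow_left k)
  have powQ : ∀ d ∈ Q, ∃ k, d ^ q ^ k = 1 := fun d hd ↦ by
    obtain ⟨k, hk⟩ := hQq ⟨d, hd⟩
    exact ⟨k, by simpa [Subtype.ext_iff] using hk⟩
  have hconj : ∀ d ∈ Q, ∀ (x : G) (m : ℕ), x ^ m = 1 → m.Coprime q →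
      x * d * x⁻¹ ∈ Subgroup.zpowers d := fun d hd x m hx hm ↦
    hPT.conj_mem_of_coprime hQ hQq (Subgroup.zpowers_le.2 hd) hx hm (Subgroup.mem_zpowers d)
  set π := QuotientGroup.mk' Q with hπ
  have hπs : Function.Surjective π := QuotientGroup.mk'_surjective Q
  have hπ1 : ∀ x, π x = 1 ↔ x ∈ Q := fun x ↦ by
    rw [← MonoidHom.mem_ker, hπ, QuotientGroup.ker_mk']
  obtain ⟨B, hBc, hBpow, hBhall, K, _, _, φ, hφ⟩ := ih (Nat.card (G ⧸ Q)) (by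
      rw [← hn, ← Q.card_mul_index, ← Subgroup.index_eq_card]
      exact lt_mul_of_one_lt_left (Nat.pos_of_ne_zero Subgroup.index_ne_zero_of_finite) hQcard)
    (G ⧸ Q) (hPT.of_surjective π hπs) rfl
  have hcomm : ∀ d, π d ∈ B → ∃ c ∈ commutator G, ∃ y ∈ Q, d = c * y := fun d hd ↦ by
    have h := hBc hd
    rw [commutator_def, ← Subgroup.map_top_of_surjective π hπs, ← Subgroup.map_commutator] at h
    obtain ⟨c, hc, hcd⟩ := h
    exact ⟨c, hc, c⁻¹ * d, by rw [← hπ1, map_mul, map_inv, hcd, inv_mul_cancel], by group⟩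
  have hdvd : ∀ (D : Subgroup G), D ≤ B.comap π → ∀ p : ℕ, p.Prime → p ≠ q →
      p ∣ Nat.card D → p ∣ Nat.card B := by
    intro D hD p hp hpq hpD
    have := Fact.mk hp
    obtain ⟨d, hd⟩ := exists_prime_orderOf_dvd_card' p hpD
    have h1 : π d ≠ 1 := fun h ↦ by
      obtain ⟨k, hk⟩ := powQ _ ((hπ1 _).1 h)
      have := eq_one_of_pow_eq_one_of_coprime (m := p) (by
        rw [← Subgroup.orderOf_coe] at hd; rw [← hd, pow_orderOf_eq_one]) hk
        (((Nat.coprime_primes hp hq).2 hpq).pow_right k)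
      rw [← orderOf_eq_one_iff, Subgroup.orderOf_coe, hd] at this
      exact hp.one_lt.ne' this
    have h2 : orderOf (π d) = p := orderOf_eq_prime (by
      rw [← map_pow, ← Subgroup.coe_pow, ← hd, pow_orderOf_eq_one]; simp) h1
    exact h2 ▸ B.orderOf_dvd_natCard (hD d.2)
  have hBpow' : ∀ d, π d ∈ B → ∀ p : ℕ, p.Prime → ∀ k, d ^ p ^ k = 1 → ∀ g : G,
      ∃ (i : ℤ), ∃ y ∈ Q, g * d * g⁻¹ = d ^ i * y := fun d hd p hp k hk g ↦ by
    obtain ⟨i, hi⟩ := Subgroup.mem_zpowers_iff.1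
      (hBpow _ hd p hp k (by rw [← map_pow, hk, map_one]) (π g))
    refine ⟨i, (d ^ i)⁻¹ * (g * d * g⁻¹), ?_, by group⟩
    rw [← hπ1]
    simp only [map_mul, map_inv, map_zpow, hi]
    group
  by_cases hcent : ∀ (x : G) (m : ℕ), x ^ m = 1 → m.Coprime q → ∀ d ∈ Q, x * d * x⁻¹ = d
  · obtain ⟨a, ha⟩ := IsPGroup.iff_card.1 hQq
    obtain ⟨R, hR⟩ := Subgroup.exists_right_complement'_of_coprime (N := Q)
      (by rw [ha]; exact hQi'.pow_left a)
    have hRcard : Nat.card R = Q.index := hR.symm.index_eq_card.symm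
    have hRindex : R.index = q ^ a := hR.index_eq_card.trans ha
    have powR : ∀ r ∈ R, r ^ Q.index = 1 := fun r hr ↦ by
      have := pow_card_eq_one' (x := (⟨r, hr⟩ : R))
      rw [hRcard] at this
      simpa [Subtype.ext_iff] using this
    have hRQ : ∀ r ∈ R, ∀ d ∈ Q, r * d * r⁻¹ = d := fun r hr ↦
      hcent r _ (powR r hr) hQi'.symm
    have hRn : R.Normal := ⟨fun r hr g ↦ by
      obtain ⟨⟨⟨y, hy⟩, ⟨s, hs⟩⟩, rfl⟩ := hR.surjective g
      have h1 := mul_mem (mul_mem hs hr) (inv_mem hs)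
      have h2 := hRQ _ h1 y hy
      rw [mul_inv_eq_iff_eq_mul] at h2
      have : y * s * r * (y * s)⁻¹ = s * r * s⁻¹ := by
        calc _ = y * (s * r * s⁻¹) * y⁻¹ := by group
          _ = _ := by rw [← h2]; group
      exact this.symm ▸ h1⟩
    have hQR : ∀ y ∈ Q, y ∈ R → y = 1 := fun y hy hyR ↦ by
      obtain ⟨k, hk⟩ := powQ y hy
      exact eq_one_of_pow_eq_one_of_coprime hk (powR y hyR) (hQi'.pow_left k)
    refine ⟨B.comap π ⊓ R, ?_, ?_, ?_, ?_⟩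
    · rintro d ⟨hdB, hdR⟩
      obtain ⟨c, hc, y, hy, hcy⟩ := hcomm d hdB
      obtain ⟨k, hk⟩ := powQ y hy
      rw [← QuotientGroup.eq_one_iff]
      refine eq_one_of_pow_eq_one_of_coprime (m := q ^ k) (n := Q.index) ?_ ?_ (hQi'.pow_left k)
      · rw [hcy, QuotientGroup.mk_mul, (QuotientGroup.eq_one_iff c).2 hc, one_mul,
          ← QuotientGroup.mk_pow, hk, QuotientGroup.mk_one]
      · rw [← QuotientGroup.mk_pow, powR d hdR, QuotientGroup.mk_one]
    · rintro d ⟨hdB, hdR⟩ p hp k hk g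
      obtain ⟨i, y, hy, h⟩ := hBpow' d hdB p hp k hk g
      have hyR : y ∈ R := by
        have := R.mul_mem (R.inv_mem (R.zpow_mem hdR i)) (hRn.conj_mem d hdR g)
        rwa [h, inv_mul_cancel_left] at this
      rw [h, hQR y hy hyR, mul_one]
      exact zpow_mem (Subgroup.mem_zpowers d) i
    · intro p hp hpD x k hx
      have hpq : p ≠ q := by
        rintro rfl
        exact hQi ((hpD.trans (Subgroup.card_dvd_of_le inf_le_right)).trans hRcard.dvd)
      refine ⟨hBhall p hp (hdvd _ inf_le_left p hp hpq hpD) _ k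
        (by rw [← map_pow, hx, map_one]), mem_of_pow_eq_one_of_coprime_index hx ?_⟩
      rw [hRindex]
      exact Nat.Coprime.pow _ _ ((Nat.coprime_primes hp hq).2 hpq)
    · have : Group.IsNilpotent (G ⧸ R) := by
        refine IsPGroup.isNilpotent (p := q) (IsPGroup.of_card (n := a) ?_)
        rw [← Subgroup.index_eq_card, hRindex]
      refine ⟨K × (G ⧸ R), inferInstance, inferInstance,
        (φ.comp π).prod (QuotientGroup.mk' R), ?_⟩
      rw [MonoidHom.ker_prod, QuotientGroup.ker_mk', ← MonoidHom.comap_ker, hφ]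
  · push Not at hcent
    obtain ⟨x, m, hxm, hm, d₀, hd₀, hne⟩ := hcent
    have hx : ∀ d ∈ Q, x * d * x⁻¹ ∈ Subgroup.zpowers d := fun d hd ↦ hconj d hd x m hxm hm
    have hab : ∀ d ∈ Q, ∀ e ∈ Q, Commute d e := fun d hd e he ↦
      commute_of_exists_conj_ne hQq hx hxm hm ⟨d₀, hd₀, hne⟩ hd he
    have hpow : ∀ d ∈ Q, ∀ g : G, g * d * g⁻¹ ∈ Subgroup.zpowers d := fun d hd g ↦ by
      have : g ∈ Subgroup.normalizer (Subgroup.zpowers d : Set G) := by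
        refine mem_of_forall_primePow_mem_of_finite g fun r hr k j h ↦ mem_normalizer_zpowers ?_
        by_cases hrq : r = q
        · subst hrq
          rw [(hab _ (memQ _ k h) d hd).eq, mul_inv_cancel_right]
          exact Subgroup.mem_zpowers d
        · exact hconj d hd _ _ h (((Nat.coprime_primes hr hq).2 hrq).pow_left k)
      exact (Subgroup.mem_normalizer_iff.1 this d).1 (Subgroup.mem_zpowers d)
    have hQc : Q ≤ commutator G := fun d hd ↦ by
      rcases eq_or_ne d 1 with rfl | hd1
      · exact one_mem _
      obtain ⟨ρ, hρ1, hρ⟩ := isCoprime_sub_one_of_exists_conj_ne hQq hx hxm hm ⟨d₀, hd₀, hne⟩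
      obtain ⟨r, hr⟩ := Subgroup.mem_zpowers_iff.1 (hx d hd)
      have h1 : IsCoprime (r - 1) (q : ℤ) := by
        obtain ⟨c, hc⟩ := (hρ d hd hd1 r hr.symm).dvd
        obtain ⟨a, b, hab⟩ := hρ1
        exact ⟨a, b + a * c, by linear_combination hab - a * hc⟩
      obtain ⟨k, hk⟩ := powQ d hd
      -- The commutator of `x` and `d` is `d ^ (r - 1)`, a generator of `⟨d⟩`.
      refine (Subgroup.zpowers_le.2 ?_) (mem_zpowers_zpow_of_isCoprime_prime hk h1)
      rw [zpow_sub_one, hr]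
      exact Subgroup.commutator_mem_commutator (Subgroup.mem_top x) (Subgroup.mem_top d)
    have hDc : B.comap π ≤ commutator G := fun d hd ↦ by
      obtain ⟨c, hc, y, hy, rfl⟩ := hcomm d hd
      exact mul_mem hc (hQc hy)
    refine ⟨B.comap π, hDc, ?_, ?_, K, inferInstance, inferInstance, φ.comp π, ?_⟩
    · intro d hd p hp k hk g
      by_cases hpq : p = q
      · subst hpq
        exact hpow d (memQ d k hk) g
      obtain ⟨i, y, hy, h⟩ := hBpow' d hd p hp k hk g
      -- The error term `y` commutes with `d`, since `d` is in the commutator subgroup; so `y` is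
      -- both a `p`-element and a `q`-element.
      have h1 : Commute d y := by
        have := conj_eq_self_of_mem_commutator (hpow y hy) (hDc hd)
        rwa [mul_inv_eq_iff_eq_mul] at this
      have h2 : y ^ p ^ k = 1 := by
        have h3 : (g * d * g⁻¹) ^ p ^ k = 1 := by rw [conj_pow, hk]; simp
        rw [h, (h1.zpow_left i).mul_pow, ← zpow_natCast, zpow_comm, zpow_natCast, hk, one_zpow,
          one_mul] at h3
        exact h3
      obtain ⟨j, hj⟩ := powQ y hy
      have h3 : y = 1 := eq_one_of_pow_eq_one_of_coprime h2 hj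
        (Nat.Coprime.pow _ _ ((Nat.coprime_primes hp hq).2 hpq))
      rw [h, h3, mul_one]
      exact zpow_mem (Subgroup.mem_zpowers d) i
    · intro p hp hpD x k hx
      by_cases hpq : p = q
      · subst hpq
        rw [Subgroup.mem_comap, (hπ1 x).2 (memQ x k hx)]
        exact one_mem _
      · exact hBhall p hp (hdvd _ le_rfl p hp hpq hpD) _ k (by rw [← map_pow, hx, map_one])
    · rw [← MonoidHom.comap_ker, hφ]

/-! ### Modular subgroups. -/

theorem Subgroup.Normal.isModularSubgroup {N : Subgroup G} (hN : N.Normal) :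
    IsModularSubgroup N := by
  constructor
  · intro X Z hXZ
    refine le_antisymm (sup_le (le_inf le_sup_left hXZ) (inf_le_inf_right _ le_sup_right)) ?_
    rintro t ⟨ht, htZ : t ∈ Z⟩
    change t ∈ ((X ⊔ N : Subgroup G) : Set G) at ht
    rw [Subgroup.mul_normal] at ht
    obtain ⟨x, hx, n, hn, rfl⟩ := ht
    refine mul_mem (Subgroup.mem_sup_left hx) (Subgroup.mem_sup_right ⟨hn, ?_⟩)
    simpa using mul_mem (inv_mem (hXZ hx)) htZ
  · intro Y Z hZ
    refine le_antisymm (sup_le (le_inf le_sup_left hZ) (inf_le_inf_right _ le_sup_right)) ?_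
    rintro t ⟨ht, htZ : t ∈ Z⟩
    change t ∈ ((N ⊔ Y : Subgroup G) : Set G) at ht
    rw [Subgroup.normal_mul] at ht
    obtain ⟨n, hn, y, hy, rfl⟩ := ht
    refine mul_mem (Subgroup.mem_sup_left hn) (Subgroup.mem_sup_right ⟨hy, ?_⟩)
    simpa using mul_mem (inv_mem (hZ hn)) htZ

/-- A purely lattice-theoretic argument. For the first condition, `Z` and its subgroup `X ⊔ (Z ⊓ (M₁
⊔ M₂))` have the same join with `M₁`, and modularity of `M₁` then recovers `Z`. -/
theorem IsModularSubgroup.sup {M₁ M₂ : Subgroup G} (h₁ : IsModularSubgroup M₁)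
    (h₂ : IsModularSubgroup M₂) : IsModularSubgroup (M₁ ⊔ M₂) := by
  refine ⟨fun X W hXW ↦ ?_, fun Y Z hZ ↦ ?_⟩
  · refine le_antisymm (sup_le (le_inf le_sup_left hXW) (inf_le_inf_right _ le_sup_right)) ?_
    set Z := (X ⊔ (M₁ ⊔ M₂)) ⊓ W with hZ
    have hXZ : X ≤ Z := le_inf le_sup_left hXW
    have e1 : X ⊔ M₁ ⊔ (M₂ ⊓ (Z ⊔ M₁)) = Z ⊔ M₁ := by
      rw [h₂.1 _ _ (sup_le_sup_right hXZ M₁), sup_assoc, inf_eq_right]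
      exact sup_le inf_le_left (le_sup_left.trans le_sup_right)
    have e2 : M₁ ⊔ (M₂ ⊓ (Z ⊔ M₁)) = M₁ ⊔ (Z ⊓ (M₁ ⊔ M₂)) := by
      rw [h₁.2 _ _ le_sup_right, h₁.2 _ _ le_sup_left, sup_comm Z, inf_comm]
    have e3 : X ⊔ (Z ⊓ (M₁ ⊔ M₂)) ⊔ M₁ = Z ⊔ M₁ := by
      rw [← e1, sup_assoc X M₁, e2, sup_assoc, sup_comm _ M₁]
    have e4 := h₁.1 (X ⊔ (Z ⊓ (M₁ ⊔ M₂))) Z (sup_le hXZ inf_le_left)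
    rw [e3, inf_eq_right.2 (le_sup_left : Z ≤ Z ⊔ M₁)] at e4
    rw [← e4]
    refine sup_le (sup_le le_sup_left (le_sup_of_le_right ?_)) (le_sup_of_le_right ?_)
    · exact le_inf inf_le_right (inf_le_left.trans inf_le_right)
    · exact le_inf (inf_le_left.trans le_sup_left) (inf_le_right.trans inf_le_right)
  · rw [sup_assoc, sup_assoc, ← h₁.2 _ _ (le_sup_left.trans hZ), ← h₂.2 _ _ (le_sup_right.trans hZ)]

/-- Both identities hold after joining with `f.ker`, which is itself modular as a normal subgroup
and can be absorbed. -/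
theorem IsModularSubgroup.comap {Q : Type*} [Group Q] {M : Subgroup Q} (hM : IsModularSubgroup M)
    (f : G →* Q) (hf : Function.Surjective f) : IsModularSubgroup (M.comap f) := by
  have hN := f.normal_ker.isModularSubgroup
  have hle : f.ker ≤ M.comap f := f.ker_le_comap M
  refine ⟨fun X Z hXZ ↦ ?_, fun Y Z hZ ↦ ?_⟩
  · refine le_antisymm (sup_le (le_inf le_sup_left hXZ) (inf_le_inf_right _ le_sup_right)) ?_
    have h := congrArg (Subgroup.comap f) (hM.1 (X.map f) (Z.map f) (Subgroup.map_mono hXZ))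
    rw [← Subgroup.comap_sup_eq f _ _ hf, Subgroup.comap_inf, Subgroup.comap_inf,
      ← Subgroup.comap_sup_eq f _ _ hf, Subgroup.comap_map_eq, Subgroup.comap_map_eq,
      inf_comm (M.comap f), sup_comm Z, ← hN.2 _ _ hle] at h
    have hw : X ⊔ (M.comap f ⊓ Z) ≤ Z := sup_le hXZ inf_le_right
    calc (X ⊔ M.comap f) ⊓ Z ≤ (X ⊔ (M.comap f ⊓ Z) ⊔ f.ker) ⊓ Z := by
          refine le_inf ?_ inf_le_right
          calc _ ≤ (X ⊔ f.ker ⊔ M.comap f) ⊓ (f.ker ⊔ Z) :=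
                inf_le_inf (sup_le_sup_right le_sup_left _) le_sup_right
            _ = _ := by
              rw [← h, sup_comm f.ker (_ ⊓ _), inf_comm Z, sup_sup_sup_comm, sup_idem]
      _ = X ⊔ (M.comap f ⊓ Z) ⊔ (f.ker ⊓ Z) := (hN.1 _ _ hw).symm
      _ ≤ _ := sup_le le_rfl (le_sup_of_le_right (inf_le_inf_right _ hle))
  · have hNZ := hle.trans hZ
    have hZ' : (Z.map f).comap f = Z := by rw [Subgroup.comap_map_eq, sup_eq_left.2 hNZ]
    have hZ'' : M ≤ Z.map f := by
      rw [← Subgroup.map_comap_eq_self_of_surjective hf M]; exact Subgroup.map_mono hZ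
    have h := congrArg (Subgroup.comap f) (hM.2 (Y.map f) (Z.map f) hZ'')
    rw [← Subgroup.comap_sup_eq f _ _ hf, Subgroup.comap_inf, Subgroup.comap_inf,
      ← Subgroup.comap_sup_eq f _ _ hf, Subgroup.comap_map_eq, hZ', sup_comm Y,
      ← hN.2 _ _ hNZ, ← sup_assoc, ← sup_assoc, sup_eq_left.2 hle] at h
    exact h

open ArithmeticFunction in
theorem Subgroup.cardFactors_card_lt [Finite G] {A B : Subgroup G} (h : A < B) :
    cardFactors (Nat.card A) < cardFactors (Nat.card B) := by
  obtain ⟨m, hm⟩ := Subgroup.card_dvd_of_le h.le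
  have hA : Nat.card A ≠ 0 := Nat.card_pos.ne'
  have hB : Nat.card B ≠ 0 := Nat.card_pos.ne'
  have hm0 : m ≠ 0 := by rintro rfl; exact hB hm
  have hm1 : m ≠ 1 := by
    rintro rfl
    exact h.ne (Subgroup.eq_of_le_of_card_ge h.le (by rw [hm, mul_one]))
  rw [hm, cardFactors_mul hA hm0]
  have := cardFactors_eq_zero_iff_eq_zero_or_one.not.2 (not_or.2 ⟨hm0, hm1⟩)
  omega

-- A failure of the modular law would give a chain of length three from `⊥` to `⊤`, while each
-- strict inclusion costs a prime factor of the order.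
open ArithmeticFunction in
theorem isModularSubgroup_of_cardFactors_card_le_two [Finite G]
    (h : cardFactors (Nat.card G) ≤ 2) (M : Subgroup G) : IsModularSubgroup M := by
  have key : ∀ X Y Z : Subgroup G, X ≤ Z → (X ⊔ Y) ⊓ Z ≤ X ⊔ (Y ⊓ Z) := by
    intro X Y Z hXZ
    by_contra hne
    have h1 : X ⊔ (Y ⊓ Z) < (X ⊔ Y) ⊓ Z := lt_of_le_not_ge
      (sup_le (le_inf le_sup_left hXZ) (inf_le_inf_right _ le_sup_right)) hne
    have h0 : ⊥ < X ⊔ (Y ⊓ Z) := by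
      rw [bot_lt_iff_ne_bot]
      intro hb
      rw [sup_eq_bot_iff] at hb
      simp [hb.1] at hne
    have h2 : (X ⊔ Y) ⊓ Z < ⊤ := by
      rw [lt_top_iff_ne_top]
      intro ht
      rw [inf_eq_top_iff] at ht
      simp [ht.2] at hne
    have := Subgroup.cardFactors_card_lt h0
    have := Subgroup.cardFactors_card_lt h1
    have := Subgroup.cardFactors_card_lt h2
    rw [Subgroup.card_top] at this
    omega
  refine ⟨fun X Z hXZ ↦ le_antisymm
    (sup_le (le_inf le_sup_left hXZ) (inf_le_inf_right _ le_sup_right)) (key _ _ _ hXZ),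
    fun Y Z hZ ↦ le_antisymm
    (sup_le (le_inf le_sup_left hZ) (inf_le_inf_right _ le_sup_right)) (key _ _ _ hZ)⟩

open ArithmeticFunction in
theorem isModularSubgroup_of_cardFactors_index_le_two [Finite G] {N M : Subgroup G} [N.Normal]
    (h : cardFactors N.index ≤ 2) (hNM : N ≤ M) : IsModularSubgroup M := by
  have := (isModularSubgroup_of_cardFactors_card_le_two (by rwa [← N.index_eq_card])
    (M.map (QuotientGroup.mk' N))).comap _ (QuotientGroup.mk'_surjective N)
  rwa [Subgroup.comap_map_eq, QuotientGroup.ker_mk', sup_eq_left.2 hNM] at this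

/-! ### Submodular subgroups. -/

theorem isSubmodularSubgroup_top : IsSubmodularSubgroup (⊤ : Subgroup G) :=
  ⟨0, fun _ ↦ ⊤, rfl, rfl, by simp⟩

theorem IsSubmodularSubgroup.of_le {A B : Subgroup G} (hB : IsSubmodularSubgroup B) (hAB : A ≤ B)
    (h : IsModularSubgroup (A.subgroupOf B)) : IsSubmodularSubgroup A := by
  obtain ⟨n, C, h0, hn, hC⟩ := hB
  subst h0
  refine ⟨n + 1, fun i ↦ Nat.casesOn i A C, rfl, hn, fun i hi ↦ ?_⟩
  cases i with
  | zero => exact ⟨hAB, h⟩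
  | succ i => exact hC i (by omega)

/-- A subgroup containing the kernel of a homomorphism to a nilpotent group is submodular. -/
theorem isSubmodularSubgroup_of_ker_le [Finite G] {K : Type*} [Group K] [Group.IsNilpotent K]
    (φ : G →* K) (A : Subgroup G) (hA : φ.ker ≤ A) : IsSubmodularSubgroup A := by
  induction A using WellFoundedGT.induction with
  | ind A ih =>
  rcases eq_or_ne A ⊤ with rfl | hne
  · exact isSubmodularSubgroup_top
  have hs := φ.rangeRestrict_surjective
  have hcm : (A.map φ.rangeRestrict).comap φ.rangeRestrict = A := by
    rw [Subgroup.comap_map_eq, MonoidHom.ker_rangeRestrict, sup_eq_left.2 hA]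
  have hlt := Group.normalizerCondition_of_isNilpotent (G := φ.range) (A.map φ.rangeRestrict)
    (lt_top_iff_ne_top.2 fun h ↦ hne (by rw [← hcm, h, Subgroup.comap_top]))
  have hlt' : A < Subgroup.normalizer (A : Set G) := by
    refine lt_of_le_of_ne Subgroup.le_normalizer fun h ↦ hlt.ne ?_
    have h1 := Subgroup.comap_normalizer_eq_of_surjective (A.map φ.rangeRestrict) hs
    rw [hcm, ← h] at h1
    exact (Subgroup.comap_injective hs (h1.trans hcm.symm)).symm
  refine (ih _ hlt' (hA.trans hlt'.le)).of_le hlt'.le ?_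
  exact (Subgroup.normal_subgroupOf_of_le_normalizer le_rfl).isModularSubgroup

theorem Subgroup.relIndex_dvd_of_pow_mem {N : Subgroup G} [N.Normal] {x : G} {p : ℕ}
    (hx : x ^ p ∈ N) {U : Subgroup G} (hU : U ≤ N ⊔ zpowers x) : N.relIndex U ∣ p := by
  have h := Subgroup.relIndex_ker (K := U) (QuotientGroup.mk' N)
  rw [QuotientGroup.ker_mk'] at h
  have hle : U.map (QuotientGroup.mk' N) ≤ zpowers (QuotientGroup.mk' N x) := by
    refine (Subgroup.map_mono hU).trans ?_
    rw [Subgroup.map_sup, MonoidHom.map_zpowers, sup_le_iff]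
    refine ⟨?_, le_rfl⟩
    rw [Subgroup.map_le_iff_le_comap]
    intro n hn
    have : QuotientGroup.mk' N n = 1 := (QuotientGroup.eq_one_iff n).2 hn
    rw [Subgroup.mem_comap, this]
    exact one_mem _
  rw [h]
  refine (Subgroup.card_dvd_of_le hle).trans ?_
  rw [Nat.card_zpowers]
  refine orderOf_dvd_of_pow_eq_one ?_
  rw [← map_pow]
  exact (QuotientGroup.eq_one_iff _).2 hx

theorem Subgroup.card_sup_of_coprime {A B : Subgroup G} [B.Normal]
    (h : (Nat.card A).Coprime (Nat.card B)) : Nat.card ↥(A ⊔ B) = Nat.card A * Nat.card B := by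
  have h1 := Subgroup.relIndex_mul_relIndex ⊥ B (A ⊔ B) bot_le le_sup_right
  rw [Subgroup.relIndex_bot_left, Subgroup.relIndex_bot_left, Subgroup.relIndex_sup_right,
    ← Subgroup.inf_relIndex_right, inf_comm, (Subgroup.disjoint_of_coprime_natCard h).eq_bot,
    Subgroup.relIndex_bot_left] at h1
  rw [← h1, mul_comm]

open ArithmeticFunction in
theorem cardFactors_le_two_of_dvd_prime_mul_prime {n p r : ℕ} (hp : p.Prime) (hr : r.Prime)
    (h : n ∣ p * r) : cardFactors n ≤ 2 := by
  obtain ⟨c, hc⟩ := h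
  have hpr : p * r ≠ 0 := mul_ne_zero hp.ne_zero hr.ne_zero
  have hnc : n ≠ 0 ∧ c ≠ 0 := by rwa [hc, mul_ne_zero_iff] at hpr
  have := congrArg cardFactors hc
  rw [cardFactors_mul hp.ne_zero hr.ne_zero, cardFactors_apply_prime hp,
    cardFactors_apply_prime hr, cardFactors_mul hnc.1 hnc.2] at this
  omega

/-- Let all subgroups of `D` be normal and `φ` have kernel `D` and nilpotent codomain. A
`p`-subgroup `U` of order prime to `|D|` for which `U / C_U(D)` has order dividing `p` is
submodular. -/
theorem isSubmodularSubgroup_of_pow_mem_centralizer [Finite G] {D : Subgroup G}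
    (hD : ∀ H ≤ D, H.Normal) {K : Type*} [Group K] [Group.IsNilpotent K] (φ : G →* K)
    (hφ : φ.ker = D) {p : ℕ} (hp : p.Prime) {U : Subgroup G}
    (hU : (Nat.card U).Coprime (Nat.card D)) {x : G}
    (hx : x ^ p ∈ Subgroup.centralizer (D : Set G))
    (hUx : U ≤ Subgroup.centralizer (D : Set G) ⊔ Subgroup.zpowers x) :
    IsSubmodularSubgroup U := by
  have := hD D le_rfl
  set Γ := Subgroup.centralizer (D : Set G) with hΓ
  -- Descend from `K = D`, where `U ⊔ D` contains the kernel of `φ`, to `K = ⊥`.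
  have key : ∀ K ≤ D, IsSubmodularSubgroup (U ⊔ K) := by
    intro K hKD
    induction K using WellFoundedGT.induction with
    | ind K ih =>
    rcases hKD.eq_or_lt with rfl | hlt
    · exact isSubmodularSubgroup_of_ker_le φ _ (hφ.le.trans le_sup_right)
    obtain ⟨d, hdD, hdK⟩ := SetLike.exists_of_lt hlt
    obtain ⟨r, hr, m, hm, hmr⟩ := exists_pow_notMem_prime_pow_mem hdK
    set L := K ⊔ Subgroup.zpowers (d ^ m) with hL
    have hLD : L ≤ D := sup_le hKD (Subgroup.zpowers_le.2 (pow_mem hdD m))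
    have hKL : K ≤ L := le_sup_left
    have hKL' : K < L := lt_of_le_of_ne hKL fun h ↦
      hm (h ▸ Subgroup.mem_sup_right (Subgroup.mem_zpowers _))
    have := hD K hKD
    have := hD L hLD
    have hle : U ⊔ K ≤ U ⊔ L := sup_le_sup_left hKL U
    refine (ih L hKL' hLD).of_le hle ?_
    have hNle : (U ⊓ Γ) ⊔ K ≤ U ⊔ L := sup_le_sup inf_le_left hKL
    -- `D` centralises `U ⊓ Γ`. The index of this normal subgroup in `U ⊔ L` is `|U : U ⊓ Γ| * |L :
    -- K|`, a divisor of `p * r`.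
    have hN : (((U ⊓ Γ) ⊔ K).subgroupOf (U ⊔ L)).Normal := by
      refine Subgroup.normal_subgroupOf_of_le_normalizer
        (le_trans (le_inf ?_ Subgroup.le_normalizer_of_normal)
          (Subgroup.normalizer_inf_normalizer_le_normalizer_sup _ _))
      refine sup_le ?_ (hLD.trans ?_)
      · exact (le_inf Subgroup.le_normalizer Subgroup.le_normalizer_of_normal).trans
          Subgroup.inf_normalizer_le_normalizer_inf
      · intro e he
        refine Subgroup.mem_normalizer_fintype fun c hc ↦ ?_
        have : e * c * e⁻¹ = c := by
          rw [mul_inv_eq_iff_eq_mul]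
          exact Subgroup.mem_centralizer_iff.1 hc.2 e he
        exact this.symm ▸ hc
    refine isModularSubgroup_of_cardFactors_index_le_two
      (N := ((U ⊓ Γ) ⊔ K).subgroupOf (U ⊔ L)) ?_
      (Subgroup.comap_mono (sup_le_sup_right inf_le_left K))
    have hcop : ∀ A ≤ U, ∀ B ≤ D, (Nat.card A).Coprime (Nat.card B) := fun A hA B hB ↦
      (hU.of_dvd (Subgroup.card_dvd_of_le hA) (Subgroup.card_dvd_of_le hB))
    have h1 := Subgroup.relIndex_mul_relIndex ⊥ _ _ bot_le hNle
    have h2 := Subgroup.relIndex_mul_relIndex ⊥ (U ⊓ Γ) U bot_le inf_le_left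
    have h3 := Subgroup.relIndex_mul_relIndex ⊥ K L bot_le hKL
    simp only [Subgroup.relIndex_bot_left] at h1 h2 h3
    rw [Subgroup.card_sup_of_coprime (hcop _ inf_le_left _ hKD),
      Subgroup.card_sup_of_coprime (hcop _ le_rfl _ hLD), ← h2, ← h3, inf_comm U,
      Subgroup.inf_relIndex_right, inf_comm] at h1
    have h4 : ((U ⊓ Γ) ⊔ K).relIndex (U ⊔ L) = Γ.relIndex U * K.relIndex L := by
      refine Nat.eq_of_mul_eq_mul_left (Nat.mul_pos (Nat.card_pos (α := ↥(U ⊓ Γ)))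
        (Nat.card_pos (α := K))) (h1.trans ?_)
      ring
    have h5 : ((U ⊓ Γ) ⊔ K).relIndex (U ⊔ L) ∣ p * r := h4 ▸
      mul_dvd_mul (Subgroup.relIndex_dvd_of_pow_mem hx hUx)
        (Subgroup.relIndex_dvd_of_pow_mem hmr le_rfl)
    exact cardFactors_le_two_of_dvd_prime_mul_prime hp hr h5
  simpa using key ⊥ bot_le

/-! ### What modularity of `(U ∩ C_G(D))⟨x⟩` forces on `U`. -/

theorem commutator_le_centralizer_of_conj_mem_zpowers {D : Subgroup G}
    (hD : ∀ d ∈ D, ∀ g : G, g * d * g⁻¹ ∈ Subgroup.zpowers d) :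
    commutator G ≤ Subgroup.centralizer (D : Set G) :=
  fun c hc ↦ Subgroup.mem_centralizer_iff.2 fun d hd ↦ by
    have := conj_eq_self_of_mem_commutator (hD d hd) hc
    rwa [mul_inv_eq_iff_eq_mul, eq_comm] at this

theorem exists_primePow_not_commute [Finite G] {D : Subgroup G} {x : G}
    (hx : x ∉ Subgroup.centralizer (D : Set G)) :
    ∃ g ∈ D, ∃ q : ℕ, q.Prime ∧ (∃ k, g ^ q ^ k = 1) ∧ ¬ Commute x g := by
  by_contra! h
  refine hx (Subgroup.mem_centralizer_iff.2 fun d hd ↦ ?_)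
  refine Subgroup.mem_centralizer_singleton_iff.1
    (mem_of_forall_primePow_mem_of_finite (H := Subgroup.centralizer {x}) d fun q hq k m hm ↦ ?_)
  exact Subgroup.mem_centralizer_singleton_iff.2 (h _ (pow_mem hd m) q hq ⟨k, hm⟩).symm.eq

/-- Apply the modular law for `V` to `Y = ⟨g y g⁻¹⟩` and `Z = V⟨y⟩`. The join of `V` and `Y`
contains `g`, hence `y`, whereas `Y ∩ Z ≤ ⟨y ^ p⟩`; so `y ∈ V ⊔ ⟨y ^ p⟩`, and the last factor can be
dropped. -/
theorem mem_sup_zpowers_of_not_commute [Finite G] {D : Subgroup G}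
    (hD : ∀ d ∈ D, ∀ g : G, g * d * g⁻¹ ∈ Subgroup.zpowers d) {p : ℕ} (hp : p.Prime)
    (hpD : ¬ p ∣ Nat.card D) {U : Subgroup G} (hU : IsPGroup p U) {x : G} (hx : x ∈ U)
    (hV : IsModularSubgroup ((U ⊓ Subgroup.centralizer (D : Set G)) ⊔ Subgroup.zpowers x))
    {g : G} (hg : g ∈ D) {q k : ℕ} (hq : q.Prime) (hgq : g ^ q ^ k = 1) (hxg : ¬ Commute x g)
    {y : G} (hy : y ∈ U) (hyg : ¬ Commute y g) :
    y ∈ Subgroup.centralizer (D : Set G) ⊔ Subgroup.zpowers x := by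
  have := Fact.mk hp
  set Γ := Subgroup.centralizer (D : Set G) with hΓ
  set V := (U ⊓ Γ) ⊔ Subgroup.zpowers x with hVdef
  have hcΓ : commutator G ≤ Γ := commutator_le_centralizer_of_conj_mem_zpowers hD
  have hDn : D.Normal := ⟨fun d hd c ↦ (Subgroup.zpowers_le.2 hd) (hD d hd c)⟩
  have hVU : V ≤ U := sup_le inf_le_left (Subgroup.zpowers_le.2 hx)
  have hpow : ∀ u ∈ U, ∃ a, u ^ p ^ a = 1 := fun u hu ↦ by
    obtain ⟨a, ha⟩ := hU ⟨u, hu⟩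
    exact ⟨a, by simpa [Subtype.ext_iff] using ha⟩
  have hcop : ∀ a, (p ^ a).Coprime (Nat.card D) := fun a ↦
    (hp.coprime_iff_not_dvd.2 hpD).pow_left a
  have hcard : ∀ d ∈ D, d ^ Nat.card D = 1 := fun d hd ↦ by
    exact congrArg Subtype.val (pow_card_eq_one' (x := (⟨d, hd⟩ : D)))
  have hUD : ∀ u ∈ U, u ∈ D → u = 1 := fun u hu huD ↦ by
    obtain ⟨a, ha⟩ := hpow u hu
    exact eq_one_of_pow_eq_one_of_coprime ha (hcard u huD) (hcop a)
  have hpq : p ≠ q := by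
    rintro rfl
    have := eq_one_of_pow_eq_one_of_coprime hgq (hcard g hg) (hcop k)
    exact hyg (this ▸ Commute.one_right y)
  have hpq' : p.Coprime q := (Nat.coprime_primes hp hq).2 hpq
  have hact : ∀ u ∈ U, ¬ Commute u g →
      ∃ r : ℤ, u⁻¹ * g * u = g ^ r ∧ IsCoprime (r - 1) (q : ℤ) := fun u hu hug ↦ by
    obtain ⟨r, hr⟩ := Subgroup.mem_zpowers_iff.1 (hD g hg u⁻¹)
    obtain ⟨a, ha⟩ := hpow u hu
    refine ⟨r, by rw [hr, inv_inv], isCoprime_sub_one_of_conj_ne (n := p ^ a) hq hgq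
      (by rw [inv_pow, ha, inv_one]) (hpq'.pow_left a) hr.symm fun h ↦ hug ?_⟩
    rw [inv_inv, mul_assoc, inv_mul_eq_iff_eq_mul] at h
    exact h.symm
  obtain ⟨r, hr, hr1⟩ := hact x hx hxg
  obtain ⟨s, hs, hs1⟩ := hact y hy hyg
  set Y := Subgroup.zpowers (g * y * g⁻¹) with hY
  set Z := V ⊔ Subgroup.zpowers y with hZ
  have hZU : Z ≤ U := sup_le hVU (Subgroup.zpowers_le.2 hy)
  have hyVY : y ∈ V ⊔ Y := by
    have hxW : x ∈ V ⊔ Y := Subgroup.mem_sup_left (Subgroup.mem_sup_right (Subgroup.mem_zpowers x))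
    have hwW : g * y * g⁻¹ ∈ V ⊔ Y := Subgroup.mem_sup_right (Subgroup.mem_zpowers _)
    have hcV : x⁻¹ * y⁻¹ * x * y ∈ V := by
      refine Subgroup.mem_sup_left ⟨U.mul_mem (U.mul_mem (U.mul_mem (U.inv_mem hx) (U.inv_mem hy)) hx) hy,
        hcΓ ?_⟩
      have := Subgroup.commutator_mem_commutator (Subgroup.mem_top x⁻¹) (Subgroup.mem_top y⁻¹)
      rwa [commutatorElement_def, inv_inv, inv_inv] at this
    have hcg : Commute (x⁻¹ * y⁻¹ * x * y) g := by
      have h1 : x⁻¹ * y⁻¹ * x * y ∈ Γ := by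
        have := Subgroup.commutator_mem_commutator (Subgroup.mem_top x⁻¹) (Subgroup.mem_top y⁻¹)
        rw [commutatorElement_def, inv_inv, inv_inv] at this
        exact hcΓ this
      exact (Subgroup.mem_centralizer_iff.1 h1 g hg).symm
    have hw : g * y * g⁻¹ = y * g ^ (s - 1) := by
      rw [zpow_sub_one, ← hs]; group
    have h1 : (g * y * g⁻¹)⁻¹ * x * (g * y * g⁻¹) =
        g ^ (1 - s) * x * g ^ (s - 1) * (x⁻¹ * y⁻¹ * x * y) := by
      rw [mul_assoc _ _ (x⁻¹ * y⁻¹ * x * y), ← (hcg.zpow_right (s - 1)).eq, hw]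
      group
    have h2 : x⁻¹ * (g ^ (1 - s) * x * g ^ (s - 1)) = g ^ ((r - 1) * (1 - s)) := by
      have h3 : x⁻¹ * g ^ (1 - s) * x = g ^ (r * (1 - s)) := by
        have := conj_zpow (a := x⁻¹) (b := g) (i := 1 - s)
        rw [inv_inv] at this
        rw [← this, hr, ← zpow_mul]
      calc _ = x⁻¹ * g ^ (1 - s) * x * g ^ (s - 1) := by group
        _ = _ := by rw [h3, ← zpow_add]; congr 1; ring
    -- Up to an element of `V`, this is the commutator of `x` with `g y g⁻¹`. Its exponent is prime
    -- to `q`, so it generates `⟨g⟩`.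
    have h3 : g ^ ((r - 1) * (1 - s)) ∈ V ⊔ Y := by
      rw [← h2]
      refine mul_mem (inv_mem hxW) ?_
      have := mul_mem (mul_mem (mul_mem (inv_mem hwW) hxW) hwW)
        (inv_mem (Subgroup.mem_sup_left (T := Y) hcV))
      rwa [h1, mul_inv_cancel_right] at this
    have hgW : g ∈ V ⊔ Y := by
      refine (Subgroup.zpowers_le.2 h3) (mem_zpowers_zpow_of_isCoprime_prime hgq (hr1.mul_left ?_))
      rw [← neg_sub]
      exact hs1.neg_left
    have := mul_mem (mul_mem (inv_mem hgW) hwW) hgW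
    rwa [show g⁻¹ * (g * y * g⁻¹) * g = y by group] at this
  have hYZ : Y ⊓ Z ≤ Subgroup.zpowers (y ^ p) := by
    rintro w ⟨hwY, hwZ⟩
    obtain ⟨i, rfl⟩ := Subgroup.mem_zpowers_iff.1 hwY
    have hwU := hZU hwZ
    rw [conj_zpow] at hwU
    -- `g y ^ i g⁻¹` and `y ^ i` both lie in `U` and differ by an element of `D`; as `U ∩ D = 1`,
    -- they coincide.
    have h1 : g * y ^ i * g⁻¹ * (y ^ i)⁻¹ = 1 := by
      refine hUD _ (mul_mem hwU (inv_mem (zpow_mem hy i))) ?_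
      have := mul_mem hg (hDn.conj_mem _ (inv_mem hg) (y ^ i))
      rwa [← mul_assoc, ← mul_assoc] at this
    rw [mul_inv_eq_one] at h1
    have hgi : Commute (y ^ i) g := (mul_inv_eq_iff_eq_mul.1 h1).symm
    by_cases hpi : (p : ℤ) ∣ i
    · obtain ⟨j, rfl⟩ := hpi
      rw [conj_zpow, h1]
      exact Subgroup.mem_zpowers_iff.2 ⟨j, by rw [← zpow_natCast, ← zpow_mul]⟩
    · obtain ⟨a, ha⟩ := hpow y hy
      obtain ⟨j, hj⟩ := Subgroup.mem_zpowers_iff.1 (mem_zpowers_zpow_of_isCoprime_prime ha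
        ((Nat.prime_iff_prime_int.1 hp).coprime_iff_not_dvd.2 hpi).symm)
      exact absurd (hj ▸ hgi.zpow_left j) hyg
  have hmem : y ∈ V ⊔ (Y ⊓ Z) := by
    rw [hV.2 Y Z le_sup_left]
    exact ⟨hyVY, Subgroup.mem_sup_right (Subgroup.mem_zpowers y)⟩
  have hWn : (Γ ⊔ Subgroup.zpowers x).Normal := Subgroup.Normal.of_commutator_le G (hcΓ.trans le_sup_left)
  have hmem' : y ∈ (Γ ⊔ Subgroup.zpowers x) ⊔ Subgroup.zpowers (y ^ p) :=
    sup_le_sup (sup_le_sup_right inf_le_right _) hYZ hmem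
  rw [← SetLike.mem_coe, Subgroup.normal_mul] at hmem'
  obtain ⟨w, hw, _, ⟨j, rfl⟩, hwy⟩ := hmem'
  obtain ⟨a, ha⟩ := hpow y hy
  -- The exponent is `1` modulo `p`, so `w` generates `⟨y⟩`.
  have h1 : w = y ^ (1 - p * j) := by
    rw [eq_mul_inv_of_mul_eq hwy, zpow_sub, zpow_one, zpow_mul, zpow_natCast]
  refine (Subgroup.zpowers_le.2 (h1 ▸ hw)) (mem_zpowers_zpow_of_isCoprime_prime ha ?_)
  exact ⟨1, j, by ring⟩

theorem le_sup_zpowers_of_isModularSubgroup [Finite G] {D : Subgroup G}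
    (hD : ∀ d ∈ D, ∀ g : G, g * d * g⁻¹ ∈ Subgroup.zpowers d) {p : ℕ} (hp : p.Prime)
    (hpD : ¬ p ∣ Nat.card D) {U : Subgroup G} (hU : IsPGroup p U) {x : G} (hx : x ∈ U)
    (hxD : x ∉ Subgroup.centralizer (D : Set G))
    (hV : IsModularSubgroup ((U ⊓ Subgroup.centralizer (D : Set G)) ⊔ Subgroup.zpowers x)) :
    U ≤ Subgroup.centralizer (D : Set G) ⊔ Subgroup.zpowers x := by
  obtain ⟨g, hg, q, hq, ⟨k, hk⟩, hxg⟩ := exists_primePow_not_commute hxD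
  intro y hy
  by_cases hyg : Commute y g
  · have h1 : ¬ Commute (x * y) g := fun h ↦ hxg (by
      simpa using h.mul_left hyg.inv_left)
    have h2 := mem_sup_zpowers_of_not_commute hD hp hpD hU hx hV hg hq hk hxg (mul_mem hx hy) h1
    have h3 := mul_mem (inv_mem (Subgroup.mem_sup_right (Subgroup.mem_zpowers x))) h2
    rwa [inv_mul_cancel_left] at h3
  · exact mem_sup_zpowers_of_not_commute hD hp hpD hU hx hV hg hq hk hxg hy hyg

/-! ### The two claims. -/

theorem IsPTGroup.isModularSubgroup_of_isPGroup [Finite G] [Group.IsSolvable G]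
    (hPT : IsPTGroup G) {p : ℕ} (hp : p.Prime)
    (h : ∀ U : Subgroup G, IsPGroup p U → IsSubmodularSubgroup U → IsModularSubgroup U)
    {U : Subgroup G} (hU : IsPGroup p U) : IsModularSubgroup U := by
  have := Fact.mk hp
  obtain ⟨D, -, hDpow, hDhall, K, _, _, φ, hφ⟩ := IsPTGroup.exists_nilpotent_residual _ G hPT rfl
  have hDn : ∀ H ≤ D, H.Normal := fun H hH ↦
    Subgroup.normal_of_forall_conj_mem_zpowers fun d hd ↦ hDpow d (hH hd)
  have hD : ∀ d ∈ D, ∀ g : G, g * d * g⁻¹ ∈ Subgroup.zpowers d := fun d hd g ↦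
    (hDn _ (Subgroup.zpowers_le.2 hd)).conj_mem d (Subgroup.mem_zpowers d) g
  have hpow : ∀ u ∈ U, ∃ a, u ^ p ^ a = 1 := fun u hu ↦ by
    obtain ⟨a, ha⟩ := hU ⟨u, hu⟩
    exact ⟨a, by simpa [Subtype.ext_iff] using ha⟩
  by_cases hpD : p ∣ Nat.card D
  · refine (hDn U fun u hu ↦ ?_).isModularSubgroup
    obtain ⟨a, ha⟩ := hpow u hu
    exact hDhall p hp hpD u a ha
  have hcop : ∀ V ≤ U, (Nat.card V).Coprime (Nat.card D) := fun V hVU ↦ by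
    obtain ⟨a, ha⟩ := IsPGroup.iff_card.1 (hU.to_le hVU)
    rw [ha]
    exact (hp.coprime_iff_not_dvd.2 hpD).pow_left a
  have key : ∀ V ≤ U, ∀ x : G, x ^ p ∈ Subgroup.centralizer (D : Set G) →
      V ≤ Subgroup.centralizer (D : Set G) ⊔ Subgroup.zpowers x → IsModularSubgroup V :=
    fun V hVU x hx hVx ↦ h V (hU.to_le hVU)
      (isSubmodularSubgroup_of_pow_mem_centralizer hDn φ hφ hp (hcop V hVU) hx hVx)
  by_cases hUD : U ≤ Subgroup.centralizer (D : Set G)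
  · exact key U le_rfl 1 (by rw [one_pow]; exact one_mem _) (hUD.trans le_sup_left)
  obtain ⟨u, hu, huD⟩ := SetLike.not_le_iff_exists.1 hUD
  obtain ⟨r, hr, m, hm, hmr⟩ := exists_pow_notMem_prime_pow_mem huD
  have hxU : u ^ m ∈ U := pow_mem hu m
  -- The image of `u ^ m` modulo the centraliser is a nontrivial `p`-element killed by `r`.
  have hrp : r = p := by
    by_contra hne
    have := hDn D le_rfl
    obtain ⟨a, ha⟩ := hpow _ hxU
    refine hm ((QuotientGroup.eq_one_iff _).1 (eq_one_of_pow_eq_one_of_coprime (m := r)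
      (n := p ^ a) ((QuotientGroup.eq_one_iff _).2 hmr) ?_
      (((Nat.coprime_primes hr hp).2 hne).pow_right a)))
    rw [← QuotientGroup.mk_pow, ha, QuotientGroup.mk_one]
  subst hrp
  have hV := key ((U ⊓ Subgroup.centralizer (D : Set G)) ⊔ Subgroup.zpowers (u ^ m))
    (sup_le inf_le_left (Subgroup.zpowers_le.2 hxU)) _ hmr (sup_le_sup_right inf_le_right _)
  exact key U le_rfl _ hmr (le_sup_zpowers_of_isModularSubgroup hD hp hpD hU hxU hm hV)

/-- A finite group all of whose subgroups of prime power order are modular is an `M`-group. -/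
theorem isMGroup_of_forall_isPGroup_isModularSubgroup [Finite G]
    (h : ∀ p : ℕ, p.Prime → ∀ U : Subgroup G, IsPGroup p U → IsModularSubgroup U) :
    IsMGroup G := by
  have key : ∀ X : Subgroup G, IsModularSubgroup X := by
    intro X
    have hbot : IsModularSubgroup (⊥ : Subgroup G) :=
      (inferInstance : (⊥ : Subgroup G).Normal).isModularSubgroup
    -- A maximal modular subgroup inside `X` absorbs every cyclic subgroup of `X` of prime power
    -- order.
    obtain ⟨M, hM⟩ := (Set.toFinite {M : Subgroup G | M ≤ X ∧ IsModularSubgroup M}).exists_maximal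
      ⟨⊥, bot_le, hbot⟩
    have hXM : X ≤ M := fun x hx ↦
      mem_of_forall_primePow_mem_of_finite x fun q hq k m hm ↦ by
        have hP : IsPGroup q (Subgroup.zpowers (x ^ m)) := by
          refine IsPGroup.of_card_dvd_pow (n := k) ?_
          rw [Nat.card_zpowers]
          exact orderOf_dvd_of_pow_eq_one hm
        exact hM.le_of_ge ⟨sup_le hM.prop.1 (Subgroup.zpowers_le.2 (pow_mem hx m)),
          hM.prop.2.sup (h q hq _ hP)⟩ le_sup_left
          (Subgroup.mem_sup_right (Subgroup.mem_zpowers _))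
    exact hXM.antisymm hM.prop.1 ▸ hM.prop.2
  exact ⟨fun {X} Y {Z} hXZ ↦ ((key Y).1 X Z hXZ).ge⟩

end

theorem proposition4p13 (G : Type*) [Group G] [Finite G] [Group.IsSolvable G] (hPT : IsPTGroup G) :
    (∀ p : ℕ, p.Prime →
      (∀ U : Subgroup G, IsPGroup p U → IsSubmodularSubgroup U → IsModularSubgroup U) →
      ∀ U : Subgroup G, IsPGroup p U → IsModularSubgroup U) ∧
    ((∀ U : Subgroup G, IsSubmodularSubgroup U → IsModularSubgroup U) → IsMGroup G) :=
  ⟨fun _ hp h _ hU ↦ hPT.isModularSubgroup_of_isPGroup hp h hU,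
    fun h ↦ isMGroup_of_forall_isPGroup_isModularSubgroup fun _ hp _ hU ↦
      hPT.isModularSubgroup_of_isPGroup hp (fun V _ ↦ h V) hU⟩
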